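/- **Setting.** Let $\mathcal G$ be a compact topological groupoid with Hausdorff unit space $X$, source map $s$ and range map $r$. For $u,v\in X$ let $\mathcal G_u^v=\{x\in\mathcal G: s(x)=u,\ r(x)=v\}$, and assume these sets are Hausdorff (for instance, $\mathcal G$ is Hausdorff). Let $(\lambda_u^v)$ be the normalized Haar system: Radon measures $\lambda_u^v$ on $\mathcal G_u^v$, of total mass one whenever $\mathcal G_u^v\neq\emptyset$, such that right translation $y\mapsto yx$ by $x\in\mathcal G_w^u$ carries $\lambda_u^v$ to $\lambda_w^v$. A representation $\pi$ of $\mathcal G$ is a continuous field of Hilbert spaces $(H_u^\pi)_{u\in X}$ with unitaries $\pi(x):H^\pi_{s(x)}\to H^\pi_{r(x)}$ that are multiplicative and unital and for which $x\mapsto\langle\pi(x)\xi_{s(x)},\eta_{r(x)}\rangle$ is continuous for all continuous sections $\xi,\eta$. A subrepresentation is an invariant family of closed subspaces $K_u\subseteq H_u^\pi$ in which the continuous sections with values in $K$ are fibrewise dense, and $\pi$ is irreducible if it is nonzero and its only subrepresentations are $0$ and $\pi$. Let $\hat{\mathcal G}$ be the set of unitary equivalence classes of irreducible representations, with one representative $\pi$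 chosen (arbitrarily) in each class, and let $d_u^\pi=\dim H_u^\pi$. Let $\sum_\pi B(H_v^\pi,H_u^\pi)$ be the space of finitely supported families $h=(h(\pi))_{\pi\in\hat{\mathcal G}}$ with $h(\pi)\in B(H_v^\pi,H_u^\pi)$. Put $$(hk)(\pi)=h(\pi)k(\pi),\quad h^*(\pi)=h(\pi)^*,\quad \langle h,k\rangle=\sum_{\pi} d_u^\pi\,\mathrm{Tr}\big(h(\pi)^*k(\pi)\big).$$ For functions on the sets $\mathcal G_u^v$ put $$(f*g)(x)=\int f(xy^{-1})g(y)\,d\lambda_u^v(y)\quad (f \text{ on } \mathcal G_v^w,\ g \text{ on } \mathcal G_u^v,\ x\in\mathcal G_u^w),$$ $$f^*(x)=\overline{f(x^{-1})},\qquad \langle f,g\rangle=\int\bar f g\,d\lambda_u^v .$$ For $f$ on $\mathcal G_u^v$ and $h\in\sum_\pi B(H_v^\pi,H_u^\pi)$ define $$\mathfrak F_{u,v}(f)(\pi)=\int f(x)\,\pi(x^{-1})\,d\lambda_u^v(x)\in B(H_v^\pi,H_u^\pi),\qquad \mathfrak F_{u,v}^{-1}(h)(x)=\sum_{\pi}d_u^\pi\,\mathrm{Tr}\big(h(\pi)\pi(x)\big)\quad(x\in\mathcal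 G_u^v),$$ and for the opposite orientation of the arrows, with $f$ on $\mathcal G_v^u$ and the same $h$, $$\tilde{\mathfrak F}_{u,v}(f)(\pi)=\int f(x)\,\pi(x)\,d\lambda_v^u(x)\in B(H_v^\pi,H_u^\pi),\qquad \tilde{\mathfrak F}_{u,v}^{-1}(h)(x)=\sum_{\pi}d_u^\pi\,\mathrm{Tr}\big(h(\pi)\pi(x^{-1})\big)\quad(x\in\mathcal G_v^u).$$ **Proposition.** For all $u,v,w\in X$, $h,k\in\sum_\pi B(H_v^\pi,H_u^\pi)$ and $l\in\sum_\pi B(H_w^\pi,H_v^\pi)$, the functions $\mathfrak F_{u,v}^{-1}(h)$ and $\tilde{\mathfrak F}_{u,v}^{-1}(h)$ are continuous, and 1. $\mathfrak F_{u,v}\big(\mathfrak F_{u,v}^{-1}(h)\big)=h$ and $\tilde{\mathfrak F}_{u,v}\big(\tilde{\mathfrak F}_{u,v}^{-1}(h)\big)=h$; 2. $\tilde{\mathfrak F}_{u,w}^{-1}(hl)=\tilde{\mathfrak F}_{u,v}^{-1}(h)*\tilde{\mathfrak F}_{v,w}^{-1}(l)$ and $\mathfrak F_{u,w}^{-1}(hl)=\mathfrak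 F_{v,w}^{-1}(l)*\mathfrak F_{u,v}^{-1}(h)$; 3. $\mathfrak F_{v,u}^{-1}(h^*)=\big(\mathfrak F_{u,v}^{-1}(h)\big)^*$ and $\tilde{\mathfrak F}_{v,u}^{-1}(h^*)=\big(\tilde{\mathfrak F}_{u,v}^{-1}(h)\big)^*$; 4. $\langle\mathfrak F_{u,v}^{-1}(h),\mathfrak F_{u,v}^{-1}(k)\rangle=\langle h,k\rangle$ and $\langle\tilde{\mathfrak F}_{u,v}^{-1}(h),\tilde{\mathfrak F}_{u,v}^{-1}(k)\rangle=\langle h,k\rangle$. -/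

import Mathlib

open CategoryTheory MeasureTheory

universe v u w

noncomputable section

namespace CptGroupoid

/-! ## Topological groupoids

A groupoid `𝒢` with unit space `X` is a `Groupoid X`; its space of arrows is `Quiver.Total X`.
`u ⟶ v` is the set `𝒢_u^v` of the arrows with source `u` and range `v`. The product `x y` of the
arrows `y : u ⟶ v` and `x : v ⟶ w` is `y ≫ x`, and `x⁻¹` is `Groupoid.inv x`. -/

/-- The structure maps (source, range, unit, inversion, product) are continuous. -/
class IsTopologicalGroupoid (X : Type u) [Groupoid.{v} X] [TopologicalSpace X]
    [TopologicalSpace (Quiver.Total X)] : Prop where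
  continuous_source : Continuous (fun x : Quiver.Total X => x.left)
  continuous_range : Continuous (fun x : Quiver.Total X => x.right)
  continuous_unit : Continuous (fun a : X => (⟨a, a, 𝟙 a⟩ : Quiver.Total X))
  continuous_inv : Continuous
    (fun x : Quiver.Total X => (⟨x.right, x.left, Groupoid.inv x.hom⟩ : Quiver.Total X))
  continuous_mul : Continuous
    (fun p : {p : Quiver.Total X × Quiver.Total X // p.1.right = p.2.left} =>
      (⟨p.1.1.left, p.1.2.right, p.1.1.hom ≫ eqToHom p.2 ≫ p.1.2.hom⟩ : Quiver.Total X))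

variable {X : Type u} [Groupoid.{v} X] [TopologicalSpace (Quiver.Total X)]

/-- `𝒢_u^v` carries the subspace topology of the space of arrows. -/
instance homTopology (a b : X) : TopologicalSpace (a ⟶ b) :=
  TopologicalSpace.induced (fun x => (⟨a, b, x⟩ : Quiver.Total X)) inferInstance

/-- `𝒢_u^v` carries its Borel sets. -/
instance homMeasurable (a b : X) : MeasurableSpace (a ⟶ b) := borel (a ⟶ b)

instance homBorel (a b : X) : BorelSpace (a ⟶ b) := ⟨rfl⟩

/-- A normalized Haar system on the sets `𝒢_u^v`: Radon measures `λ_u^v` on `𝒢_u^v`, of total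
mass one where `𝒢_u^v` is not empty, that the right translations `y ↦ y x` respect. (Such a
system is unique.) -/
structure NormalizedHaarSystem (X : Type u) [Groupoid.{v} X]
    [TopologicalSpace (Quiver.Total X)] where
  measure : ∀ a b : X, Measure (a ⟶ b)
  regular : ∀ a b : X, (measure a b).Regular
  normalized : ∀ a b : X, Nonempty (a ⟶ b) → measure a b Set.univ = 1
  right_invariant : ∀ {a b c : X} (x : c ⟶ a),
    (measure a b).map (fun y => x ≫ y) = measure c b

/-! ## Continuous fields of Hilbert spaces and representations -/

/-- A continuous field of Hilbert spaces over `X`, given by its continuous sections. -/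
structure HilbertBundle (X : Type u) [TopologicalSpace X] where
  fiber : X → Type w
  [normed : ∀ a, NormedAddCommGroup (fiber a)]
  [innerProduct : ∀ a, InnerProductSpace ℂ (fiber a)]
  [complete : ∀ a, CompleteSpace (fiber a)]
  /-- the continuous sections -/
  sections : Submodule ℂ (∀ a, fiber a)
  continuous_norm : ∀ ξ ∈ sections, Continuous (fun a => ‖ξ a‖)
  dense : ∀ a, Dense {z : fiber a | ∃ ξ ∈ sections, ξ a = z}
  /-- a section that is locally a uniform limit of continuous sections is continuous -/
  closed : ∀ ξ : ∀ a, fiber a,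
    (∀ a, ∀ ε > 0, ∃ η ∈ sections, ∀ᶠ b in nhds a, ‖ξ b - η b‖ < ε) → ξ ∈ sections

attribute [instance] HilbertBundle.normed HilbertBundle.innerProduct HilbertBundle.complete

variable [TopologicalSpace X]

/-- A continuous unitary representation `π` of the groupoid on a continuous field of Hilbert
spaces: `π(x) : H_{s(x)} → H_{r(x)}` is unitary, `π` is multiplicative and unital, and
`x ↦ ⟨π(x) ξ(s(x)), η(r(x))⟩` is continuous for all continuous sections `ξ`, `η`. -/
structure Rep (X : Type u) [Groupoid.{v} X] [TopologicalSpace X]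
    [TopologicalSpace (Quiver.Total X)] extends HilbertBundle.{u, w} X where
  op : ∀ {a b : X}, (a ⟶ b) → (fiber a ≃ₗᵢ[ℂ] fiber b)
  op_unit : ∀ (a : X) (z : fiber a), op (𝟙 a) z = z
  op_mul : ∀ {a b c : X} (y : a ⟶ b) (x : b ⟶ c) (z : fiber a), op (y ≫ x) z = op x (op y z)
  continuous_coeff : ∀ ξ ∈ sections, ∀ η ∈ sections,
    Continuous (fun x : Quiver.Total X => inner ℂ (op x.hom (ξ x.left)) (η x.right))

/-- The bounded operator `π(x) : H_{s(x)} → H_{r(x)}`. -/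
def Rep.opCLM (π : Rep.{v, u, w} X) {a b : X} (x : a ⟶ b) : π.fiber a →L[ℂ] π.fiber b :=
  ((π.op x).toContinuousLinearEquiv : π.fiber a →L[ℂ] π.fiber b)

/-- `K` is a subrepresentation: closed subspaces `K_u ⊆ H_u`, invariant under the groupoid, that
form a continuous subfield (the continuous sections with values in `K` are fibrewise dense). -/
structure Rep.IsSubrep (π : Rep.{v, u, w} X) (K : ∀ a, Submodule ℂ (π.fiber a)) : Prop where
  isClosed : ∀ a, IsClosed (K a : Set (π.fiber a))
  invariant : ∀ {a b : X} (x : a ⟶ b), ∀ z ∈ K a, π.op x z ∈ K b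
  dense : ∀ a, ∀ z ∈ K a, z ∈ closure {y | ∃ ξ ∈ π.sections, (∀ b, ξ b ∈ K b) ∧ ξ a = y}

/-- `π` is nonzero and has no subrepresentations except zero and itself. -/
def Rep.IsIrreducible (π : Rep.{v, u, w} X) : Prop :=
  (∃ a, Nontrivial (π.fiber a)) ∧
    ∀ K : ∀ a, Submodule ℂ (π.fiber a), π.IsSubrep K → (∀ a, K a = ⊥) ∨ (∀ a, K a = ⊤)

/-- Unitary equivalence: a continuous bundle of unitaries that intertwines. -/
def Rep.UnitaryEquiv (π ρ : Rep.{v, u, w} X) : Prop :=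
  ∃ U : ∀ a, π.fiber a ≃ₗᵢ[ℂ] ρ.fiber a,
    (∀ {a b : X} (x : a ⟶ b) (z : π.fiber a), U b (π.op x z) = ρ.op x (U a z)) ∧
    ∀ ξ : ∀ a, π.fiber a, ξ ∈ π.sections ↔ (fun a => U a (ξ a)) ∈ ρ.sections

theorem Rep.UnitaryEquiv.refl (π : Rep.{v, u, w} X) : π.UnitaryEquiv π :=
  ⟨fun _ => LinearIsometryEquiv.refl ℂ _, fun _ _ => rfl, fun _ => Iff.rfl⟩

theorem Rep.UnitaryEquiv.symm {π ρ : Rep.{v, u, w} X} (h : π.UnitaryEquiv ρ) :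
    ρ.UnitaryEquiv π := by
  obtain ⟨U, h1, h2⟩ := h
  refine ⟨fun a => (U a).symm, fun {a b} x z => ?_, fun ξ => ?_⟩
  · apply (U b).injective
    simp [h1]
  · rw [h2]
    simp

theorem Rep.UnitaryEquiv.trans {π ρ τ : Rep.{v, u, w} X} (h : π.UnitaryEquiv ρ)
    (k : ρ.UnitaryEquiv τ) : π.UnitaryEquiv τ := by
  obtain ⟨U, h1, h2⟩ := h
  obtain ⟨V, k1, k2⟩ := k
  refine ⟨fun a => (U a).trans (V a), fun {a b} x z => ?_, fun ξ => ?_⟩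
  · simp [h1, k1]
  · rw [h2, k2]
    simp

/-- The irreducible representations. -/
def IrrRep (X : Type u) [Groupoid.{v} X] [TopologicalSpace X]
    [TopologicalSpace (Quiver.Total X)] : Type (max u v (w + 1)) :=
  {π : Rep.{v, u, w} X // π.IsIrreducible}

instance irrSetoid (X : Type u) [Groupoid.{v} X] [TopologicalSpace X]
    [TopologicalSpace (Quiver.Total X)] : Setoid (IrrRep.{v, u, w} X) where
  r π ρ := π.1.UnitaryEquiv ρ.1
  iseqv := ⟨fun π => .refl π.1, fun h => h.symm, fun h k => h.trans k⟩

/-- The dual `𝒢^`: unitary equivalence classes of irreducible representations. -/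
def Dual (X : Type u) [Groupoid.{v} X] [TopologicalSpace X]
    [TopologicalSpace (Quiver.Total X)] : Type (max u v (w + 1)) :=
  Quotient (irrSetoid.{v, u, w} X)

/-- A choice of a representative in every class of the dual. -/
structure Selection (X : Type u) [Groupoid.{v} X] [TopologicalSpace X]
    [TopologicalSpace (Quiver.Total X)] where
  irr : Dual.{v, u, w} X → IrrRep.{v, u, w} X
  mk_irr : ∀ c, Quotient.mk _ (irr c) = c

/-- The representative of the class `c`. -/
def Selection.rep (σ : Selection.{v, u, w} X) (c : Dual.{v, u, w} X) : Rep.{v, u, w} X :=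
  (σ.irr c).1

/-- The fibre `H_a^π` of the representative `π` of the class `c`. -/
abbrev Selection.fib (σ : Selection.{v, u, w} X) (c : Dual.{v, u, w} X) (a : X) : Type w :=
  (σ.rep c).fiber a

/-- The operator `π(x)` for the representative `π` of the class `c`. -/
abbrev Selection.op (σ : Selection.{v, u, w} X) (c : Dual.{v, u, w} X) {a b : X} (x : a ⟶ b) :
    σ.fib c a →L[ℂ] σ.fib c b :=
  (σ.rep c).opCLM x

/-- The dimension `d_a^π`. -/
def Selection.dim (σ : Selection.{v, u, w} X) (c : Dual.{v, u, w} X) (a : X) : ℕ :=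
  Module.finrank ℂ (σ.fib c a)

/-! ## The algebraic direct sums `∑_π B(H_a^π, H_b^π)` -/

/-- `∑_π B(H_a^π, H_b^π)`: finitely supported families of operators. -/
abbrev OpSum (σ : Selection.{v, u, w} X) (a b : X) :=
  Π₀ c : Dual.{v, u, w} X, (σ.fib c a →L[ℂ] σ.fib c b)

/-- The componentwise product `(hk)(π) = h(π) k(π)`. -/
def OpSum.mul {σ : Selection.{v, u, w} X} {a b c : X} (h : OpSum σ b c) (k : OpSum σ a b) :
    OpSum σ a c :=
  DFinsupp.zipWith (fun _ S T => S.comp T) (fun _ => by simp) h k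

/-- The componentwise adjoint `h^*(π) = h(π)^*`. -/
def OpSum.star {σ : Selection.{v, u, w} X} {a b : X} (h : OpSum σ a b) : OpSum σ b a :=
  DFinsupp.mapRange (fun _ S => ContinuousLinearMap.adjoint S) (fun _ => by simp) h

/-- `⟨h, k⟩ = ∑_π d_u^π Tr(h(π)^* k(π))` for `h`, `k` in `∑_π B(H_v^π, H_u^π)`. -/
def OpSum.ip {σ : Selection.{v, u, w} X} {a b : X} (h k : OpSum σ b a) : ℂ :=
  ∑ᶠ c, (σ.dim c a : ℂ) *
    LinearMap.trace ℂ (σ.fib c b) ((ContinuousLinearMap.adjoint (h c)).comp (k c)).toLinearMap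

/-! ## Functions on `𝒢_u^v` -/

/-- `(f * g)(x) = ∫ f(x y⁻¹) g(y) dλ_u^v(y)` for `x ∈ 𝒢_u^w`, `f` on `𝒢_v^w`, `g` on `𝒢_u^v`. -/
def conv (μ : NormalizedHaarSystem X) {a b c : X} (f : (b ⟶ c) → ℂ) (g : (a ⟶ b) → ℂ) :
    (a ⟶ c) → ℂ :=
  fun x => ∫ y, f (Groupoid.inv y ≫ x) * g y ∂(μ.measure a b)

/-- `f^*(x) = conj f(x⁻¹)`. -/
def involution {a b : X} (f : (a ⟶ b) → ℂ) : (b ⟶ a) → ℂ :=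
  fun x => starRingEnd ℂ (f (Groupoid.inv x))

/-- `⟨f, g⟩ = ∫ conj(f) g dλ_u^v`. -/
def ip (μ : NormalizedHaarSystem X) {a b : X} (f g : (a ⟶ b) → ℂ) : ℂ :=
  ∫ x, starRingEnd ℂ (f x) * g x ∂(μ.measure a b)

/-! ## Fourier transforms -/

/-- `F_{u,v}(f)(π) = ∫ f(x) π(x⁻¹) dλ_u^v(x) ∈ B(H_v^π, H_u^π)`, for `f` on `𝒢_u^v`. -/
def fourier (μ : NormalizedHaarSystem X) (σ : Selection.{v, u, w} X) {a b : X}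
    (f : (a ⟶ b) → ℂ) (c : Dual.{v, u, w} X) : σ.fib c b →L[ℂ] σ.fib c a :=
  ∫ x, f x • σ.op c (Groupoid.inv x) ∂(μ.measure a b)

/-- `F_{u,v}⁻¹(h)(x) = ∑_π d_u^π Tr(h(π) π(x))`, for `h` in `∑_π B(H_v^π, H_u^π)` and
`x ∈ 𝒢_u^v`. -/
def invFourier (σ : Selection.{v, u, w} X) {a b : X} (h : OpSum σ b a) : (a ⟶ b) → ℂ :=
  fun x => ∑ᶠ c, (σ.dim c a : ℂ) *
    LinearMap.trace ℂ (σ.fib c a) ((h c).comp (σ.op c x)).toLinearMap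

/-- The same transform for the opposite orientation of the arrows:
`∫ f(x) π(x) dλ_v^u(x) ∈ B(H_v^π, H_u^π)`, for `f` on `𝒢_v^u`. -/
def fourierOp (μ : NormalizedHaarSystem X) (σ : Selection.{v, u, w} X) {a b : X}
    (f : (b ⟶ a) → ℂ) (c : Dual.{v, u, w} X) : σ.fib c b →L[ℂ] σ.fib c a :=
  ∫ x, f x • σ.op c x ∂(μ.measure b a)

/-- The inverse for the opposite orientation: `∑_π d_u^π Tr(h(π) π(x⁻¹))`, for `h` in
`∑_π B(H_v^π, H_u^π)` and `x ∈ 𝒢_v^u`. -/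
def invFourierOp (σ : Selection.{v, u, w} X) {a b : X} (h : OpSum σ b a) : (b ⟶ a) → ℂ :=
  fun x => ∑ᶠ c, (σ.dim c a : ℂ) *
    LinearMap.trace ℂ (σ.fib c a) ((h c).comp (σ.op c (Groupoid.inv x))).toLinearMap

end CptGroupoid

end

/-! As in Peter–Weyl theory for compact groups, everything rests on orthogonality relations for the
coefficients `x ↦ ⟨e, π(x) z⟩`. Inversion is these relations in operator form. Convolutions and
inner products of inverse transforms are integrals of one such function against traces of operators
`K π(x⁻¹)` or `K π(x)`, hence traces of `K` times a Fourier coefficient (`integral_sum_trace_mul`,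
`integral_sum_trace_mul_op`), and inversion evaluates them. The rule for adjoints only uses `π(x)* =
π(x⁻¹)` and that the adjoint conjugates the trace.

The orthogonality relations need Schur's lemma on one isotropy group `𝒢_a^a`, whereas irreducibility
concerns the whole field. The bridge is `transport`: an operator `V` commuting with the isotropy at
`a` spreads over the orbit of `a` as `ρ(x) V π(x⁻¹)`. By compactness of the set of arrows leaving
`a`, this preserves continuous sections once `ρ` vanishes off the orbit (`transport_mem_sections`),
and a Urysohn function shows that irreducible representations live on one orbit
(`Rep.IsIrreducible.subsingleton_fiber`). Hence the restriction to the isotropy at `a` is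
irreducible, and it determines the class when the fibre there is nonzero.

Averaging rank one operators over `𝒢_a^b` produces isotropy intertwiners. Such an average is
compact, which forces finite dimensional fibres; by Schur's lemma it vanishes between inequivalent
representations and is otherwise a scalar, which the trace determines (`finrank_smul_average`). -/

noncomputable section

namespace CptGroupoid

/-! ### Topology of the arrow sets and closedness of orbits. -/

section Arrows

variable {X : Type u} [Groupoid.{v} X] [TopologicalSpace (Quiver.Total X)]

/-- The inclusion of `𝒢_a^b` into the space of arrows. -/
def arrow (a b : X) (x : a ⟶ b) : Quiver.Total X := ⟨a, b, x⟩

theorem isInducing_arrow (a b : X) : Topology.IsInducing (arrow a b) := ⟨rfl⟩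

/-- The set `𝒢_a` of all arrows with source `a`. -/
structure ArrowsFrom (a : X) where
  /-- the range -/
  range : X
  /-- the arrow -/
  hom : a ⟶ range

/-- The inclusion of `𝒢_a` into the space of arrows. -/
def ArrowsFrom.arrow {a : X} (x : ArrowsFrom a) : Quiver.Total X := ⟨a, x.1, x.2⟩

instance (a : X) : TopologicalSpace (ArrowsFrom a) :=
  TopologicalSpace.induced ArrowsFrom.arrow inferInstance

theorem ArrowsFrom.isInducing_arrow (a : X) : Topology.IsInducing (ArrowsFrom.arrow (a := a)) :=
  ⟨rfl⟩

variable [TopologicalSpace X] [IsTopologicalGroupoid X]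

theorem continuous_groupoid_inv (a b : X) :
    Continuous (fun x : a ⟶ b => (Groupoid.inv x : b ⟶ a)) :=
  (isInducing_arrow b a).continuous_iff.2 <|
    IsTopologicalGroupoid.continuous_inv.comp (isInducing_arrow a b).continuous

theorem continuous_comp_left {a b c : X} (x : c ⟶ a) :
    Continuous (fun y : a ⟶ b => x ≫ y) := by
  refine (isInducing_arrow c b).continuous_iff.2 ?_
  have h : Continuous (fun y : a ⟶ b =>
      (⟨(⟨c, a, x⟩, ⟨a, b, y⟩), rfl⟩ :
        {p : Quiver.Total X × Quiver.Total X // p.1.right = p.2.left})) :=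
    (continuous_const.prodMk (isInducing_arrow a b).continuous).subtype_mk _
  have h' := IsTopologicalGroupoid.continuous_mul.comp h
  simpa only [Function.comp_def, arrow, eqToHom_refl, Category.id_comp] using h'

theorem ArrowsFrom.continuous_range (a : X) : Continuous (fun x : ArrowsFrom a => x.1) :=
  IsTopologicalGroupoid.continuous_range.comp (ArrowsFrom.isInducing_arrow a).continuous

variable [CompactSpace (Quiver.Total X)]

variable (X) in
theorem compactSpace_units : CompactSpace X := by
  have h : Set.range (fun x : Quiver.Total X => x.left) = Set.univ :=
    Set.eq_univ_of_forall fun a => ⟨⟨a, a, 𝟙 a⟩, rfl⟩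
  exact ⟨h ▸ isCompact_range IsTopologicalGroupoid.continuous_source⟩

variable [T2Space X]

/-- A fibre of the source map is closed because the unit space is Hausdorff; the space of all arrows
need not be. -/
instance (a : X) : CompactSpace (ArrowsFrom a) := by
  refine ⟨(ArrowsFrom.isInducing_arrow a).isCompact_iff.2 (IsClosed.isCompact ?_)⟩
  have h : ArrowsFrom.arrow '' (Set.univ : Set (ArrowsFrom a)) =
      {x : Quiver.Total X | x.left = a} := by
    ext x
    constructor
    · rintro ⟨y, -, rfl⟩
      rfl
    · rintro rfl
      exact ⟨⟨x.right, x.hom⟩, trivial, rfl⟩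
  rw [h]
  exact isClosed_eq IsTopologicalGroupoid.continuous_source continuous_const

instance (a b : X) : CompactSpace (a ⟶ b) := by
  refine ⟨(isInducing_arrow a b).isCompact_iff.2 (IsClosed.isCompact ?_)⟩
  have h : arrow a b '' (Set.univ : Set (a ⟶ b)) =
      {x : Quiver.Total X | x.left = a} ∩ {x : Quiver.Total X | x.right = b} := by
    ext x
    constructor
    · rintro ⟨y, -, rfl⟩
      exact ⟨rfl, rfl⟩
    · rintro ⟨rfl, rfl⟩
      exact ⟨x.hom, trivial, rfl⟩
  rw [h]
  exact (isClosed_eq IsTopologicalGroupoid.continuous_source continuous_const).inter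
    (isClosed_eq IsTopologicalGroupoid.continuous_range continuous_const)

/-- The orbits are closed. -/
theorem isClosed_orbit (a : X) : IsClosed {b : X | Nonempty (a ⟶ b)} := by
  have h : {b : X | Nonempty (a ⟶ b)} = Set.range (fun x : ArrowsFrom a => x.1) := by
    ext b
    exact ⟨fun ⟨x⟩ => ⟨⟨b, x⟩, rfl⟩, fun ⟨x, hx⟩ => hx ▸ ⟨x.2⟩⟩
  rw [h]
  exact (isCompact_range (ArrowsFrom.continuous_range a)).isClosed

end Arrows

/-! ### From weak to norm continuity of representations. -/

section Continuity

variable {X : Type u} [Groupoid.{v} X] [TopologicalSpace X] [TopologicalSpace (Quiver.Total X)]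
  (π : Rep.{v, u, w} X)

@[simp]
theorem Rep.opCLM_apply {a b : X} (x : a ⟶ b) (z : π.fiber a) : π.opCLM x z = π.op x z := rfl

@[simp]
theorem Rep.op_inv_op {a b : X} (x : a ⟶ b) (z : π.fiber a) :
    π.op (Groupoid.inv x) (π.op x z) = z := by
  rw [← π.op_mul, Groupoid.comp_inv, π.op_unit]

@[simp]
theorem Rep.op_op_inv {a b : X} (x : a ⟶ b) (z : π.fiber b) :
    π.op x (π.op (Groupoid.inv x) z) = z := by
  rw [← π.op_mul, Groupoid.inv_comp, π.op_unit]

theorem Rep.inner_op_left {a b : X} (x : a ⟶ b) (z : π.fiber a) (y : π.fiber b) :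
    inner ℂ (π.op x z) y = inner ℂ z (π.op (Groupoid.inv x) y) := by
  rw [← (π.op x).inner_map_map z, π.op_op_inv]

theorem Rep.exists_section_near {a : X} (z : π.fiber a) {ε : ℝ} (hε : 0 < ε) :
    ∃ ξ ∈ π.sections, ‖z - ξ a‖ < ε := by
  obtain ⟨y, ⟨ξ, hξ, rfl⟩, hy⟩ := (π.dense a).exists_dist_lt z hε
  exact ⟨ξ, hξ, by rwa [dist_eq_norm] at hy⟩

variable {π}

/-- A section multiplied by a continuous function is continuous. -/
theorem Rep.smul_mem_sections {f : X → ℂ} (hf : Continuous f) {ξ : ∀ a, π.fiber a}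
    (hξ : ξ ∈ π.sections) : (fun a => f a • ξ a) ∈ π.sections := by
  refine π.closed _ fun a ε hε => ⟨f a • ξ, π.sections.smul_mem _ hξ, ?_⟩
  have hc : Continuous (fun b => ‖f b - f a‖ * ‖ξ b‖) :=
    (hf.sub continuous_const).norm.mul (π.continuous_norm ξ hξ)
  filter_upwards [hc.continuousAt.eventually_lt_const (by simpa using hε)] with b hb
  rwa [Pi.smul_apply, ← sub_smul, norm_smul]

/-- A map is continuous if its distance to every vector of a dense set is continuous. -/
theorem continuous_of_continuous_norm_sub {S E : Type*} [TopologicalSpace S]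
    [SeminormedAddCommGroup E] {D : Set E} (hD : Dense D) {T : S → E}
    (h : ∀ z ∈ D, Continuous (fun x => ‖T x - z‖)) : Continuous T := by
  refine continuous_iff_continuousAt.2 fun s => Metric.tendsto_nhds.2 fun ε hε => ?_
  obtain ⟨z, hz, hzs⟩ := hD.exists_dist_lt (T s) (half_pos hε)
  rw [dist_eq_norm] at hzs
  filter_upwards [(h z hz).continuousAt.eventually_lt_const hzs] with x hx
  calc dist (T x) (T s) ≤ dist (T x) z + dist (T s) z := dist_triangle_right _ _ _
    _ < ε := by rw [dist_eq_norm, dist_eq_norm]; linarith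

variable [IsTopologicalGroupoid X]

/-- `x ↦ π(x⁻¹) ξ(r(x))` is norm continuous on `𝒢_a`. -/
theorem Rep.continuous_arrowsFrom_op_inv {a : X} {ξ : ∀ a, π.fiber a} (hξ : ξ ∈ π.sections) :
    Continuous (fun x : ArrowsFrom a => π.op (Groupoid.inv x.2) (ξ x.1)) := by
  refine continuous_of_continuous_norm_sub (π.dense a) ?_
  rintro _ ⟨η, hη, rfl⟩
  have h1 : Continuous (fun x : ArrowsFrom a => inner ℂ (π.op (Groupoid.inv x.2) (ξ x.1)) (η a)) :=
    (π.continuous_coeff ξ hξ η hη).comp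
      (IsTopologicalGroupoid.continuous_inv.comp (ArrowsFrom.isInducing_arrow a).continuous)
  have h2 : Continuous (fun x : ArrowsFrom a => ‖ξ x.1‖) :=
    (π.continuous_norm ξ hξ).comp (ArrowsFrom.continuous_range a)
  -- Expanding the square and using unitarity, only the cross term involves `π`, and it is a
  -- continuous coefficient.
  have h3 : (fun x : ArrowsFrom a => ‖π.op (Groupoid.inv x.2) (ξ x.1) - η a‖) = fun x : ArrowsFrom a =>
      √(‖ξ x.1‖ ^ 2 - 2 * (inner ℂ (π.op (Groupoid.inv x.2) (ξ x.1)) (η a)).re + ‖η a‖ ^ 2) := by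
    ext x
    rw [← (π.op (Groupoid.inv x.2)).norm_map (ξ x.1)]
    rw [← Real.sqrt_sq (norm_nonneg (π.op (Groupoid.inv x.2) (ξ x.1) - η a)),
      @norm_sub_sq ℂ]
    rfl
  rw [h3]
  exact (((h2.pow 2).sub (continuous_const.mul (Complex.continuous_re.comp h1))).add
    continuous_const).sqrt

/-- `x ↦ π(x⁻¹) z` is norm continuous on `𝒢_a^b`. -/
theorem Rep.continuous_op_inv {a b : X} (z : π.fiber b) :
    Continuous (fun x : a ⟶ b => π.op (Groupoid.inv x) z) := by
  -- Sections are only known to be fibrewise dense, so `z` is approximated by some `ξ b`; as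
  -- `π(x⁻¹)` is isometric, the error is uniform in `x`.
  refine continuous_of_uniform_approx_of_continuous fun V hV => ?_
  obtain ⟨ε, hε, hεV⟩ := Metric.mem_uniformity_dist.1 hV
  obtain ⟨ξ, hξ, hz⟩ := π.exists_section_near z hε
  have hj : Continuous (fun x : a ⟶ b => (⟨b, x⟩ : ArrowsFrom a)) :=
    continuous_induced_rng.2 (isInducing_arrow a b).continuous
  refine ⟨_, (Rep.continuous_arrowsFrom_op_inv hξ).comp hj, fun x => hεV ?_⟩
  rwa [Function.comp_apply, (π.op _).dist_map, dist_eq_norm]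

/-- `x ↦ π(x) z` is norm continuous on `𝒢_a^b`. -/
theorem Rep.continuous_op {a b : X} (z : π.fiber a) : Continuous (fun x : a ⟶ b => π.op x z) := by
  convert (Rep.continuous_op_inv z).comp (continuous_groupoid_inv a b) using 2 with x
  simp [Groupoid.inv_eq_inv]

end Continuity

/-! ### Spreading isotropy intertwiners along an orbit. -/

section Transport

variable {X : Type u} [Groupoid.{v} X] [TopologicalSpace X] [TopologicalSpace (Quiver.Total X)]

/-- The operator `V` intertwines the restrictions of `π` and `ρ` to the isotropy group `𝒢_a^a`. -/
def IsotropyIntertwining (π ρ : Rep.{v, u, w} X) {a : X} (V : π.fiber a →L[ℂ] ρ.fiber a) : Prop :=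
  ∀ (y : a ⟶ a) (z : π.fiber a), V (π.op y z) = ρ.op y (V z)

open Classical in
/-- The bundle map `ρ(x) V π(x⁻¹)` over the orbit of `a`, extended by zero. -/
def transport (π ρ : Rep.{v, u, w} X) {a : X} (V : π.fiber a →L[ℂ] ρ.fiber a) (b : X) :
    π.fiber b →L[ℂ] ρ.fiber b :=
  if h : Nonempty (a ⟶ b) then
    (ρ.opCLM h.some).comp (V.comp (π.opCLM (Groupoid.inv h.some)))
  else 0

variable {π ρ : Rep.{v, u, w} X} {a : X} {V : π.fiber a →L[ℂ] ρ.fiber a}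

/-- Two arrows from `a` to `b` differ by an isotropy element at `a`, with which `V` commutes, so the
chosen arrow does not matter. -/
theorem transport_apply (hV : IsotropyIntertwining π ρ V) {b : X} (x : a ⟶ b) (z : π.fiber b) :
    transport π ρ V b z = ρ.op x (V (π.op (Groupoid.inv x) z)) := by
  have h : Nonempty (a ⟶ b) := ⟨x⟩
  have e : h.some = (h.some ≫ Groupoid.inv x) ≫ x := by simp
  rw [transport, dif_pos h]
  simp only [ContinuousLinearMap.comp_apply, Rep.opCLM_apply]
  conv_lhs => rw [e, ρ.op_mul, ← hV, ← π.op_mul]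
  simp [Groupoid.inv_eq_inv]

theorem transport_self (hV : IsotropyIntertwining π ρ V) : transport π ρ V a = V := by
  ext z
  have h := transport_apply hV (𝟙 a) z
  rw [h, ρ.op_unit, Groupoid.inv_eq_inv, IsIso.inv_id, π.op_unit]

theorem transport_of_isEmpty {b : X} (h : IsEmpty (a ⟶ b)) : transport π ρ V b = 0 :=
  dif_neg (not_nonempty_iff.2 h)

theorem transport_op (hV : IsotropyIntertwining π ρ V) {b c : X} (x : b ⟶ c) (z : π.fiber b) :
    transport π ρ V c (π.op x z) = ρ.op x (transport π ρ V b z) := by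
  by_cases h : Nonempty (a ⟶ b)
  · obtain ⟨y⟩ := h
    rw [transport_apply hV y, transport_apply hV (y ≫ x), ρ.op_mul, ← π.op_mul]
    simp [Groupoid.inv_eq_inv]
  · have h' : ¬ Nonempty (a ⟶ c) := fun ⟨y⟩ => h ⟨y ≫ Groupoid.inv x⟩
    rw [transport_of_isEmpty (not_nonempty_iff.1 h), transport_of_isEmpty (not_nonempty_iff.1 h')]
    simp

/-- The transport of an isotropy intertwining operator preserves the continuous sections. -/
theorem transport_mem_sections [IsTopologicalGroupoid X] [CompactSpace (Quiver.Total X)]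
    [T2Space X] (hV : IsotropyIntertwining π ρ V)
    (hρ : ∀ b, IsEmpty (a ⟶ b) → Subsingleton (ρ.fiber b)) {ξ : ∀ b, π.fiber b}
    (hξ : ξ ∈ π.sections) : (fun b => transport π ρ V b (ξ b)) ∈ ρ.sections := by
  refine ρ.closed _ fun c ε hε => ?_
  obtain ⟨η, hη, hc⟩ := ρ.exists_section_near (transport π ρ V c (ξ c)) hε
  refine ⟨η, hη, ?_⟩
  -- The error of the approximation, pulled back to the fixed fibre over `a`, where norm continuity
  -- is available.
  let F : ArrowsFrom a → ℝ := fun x =>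
    ‖V (π.op (Groupoid.inv x.hom) (ξ x.range)) - ρ.op (Groupoid.inv x.hom) (η x.range)‖
  have hF : Continuous F :=
    ((V.continuous.comp (Rep.continuous_arrowsFrom_op_inv hξ)).sub
      (Rep.continuous_arrowsFrom_op_inv hη)).norm
  have hFeq (x : ArrowsFrom a) : F x = ‖transport π ρ V x.range (ξ x.range) - η x.range‖ := by
    rw [transport_apply hV x.hom, ← (ρ.op (Groupoid.inv x.hom)).norm_map, map_sub, Rep.op_inv_op]
  -- The orbit points with error at least `ε` form the image of a compact set. Its complement is the
  -- required neighbourhood of `c`; off the orbit the error is zero.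
  have hC : IsClosed (ArrowsFrom.range '' {x | ε ≤ F x}) :=
    ((isClosed_le continuous_const hF).isCompact.image
      (ArrowsFrom.continuous_range a)).isClosed
  have hcC : c ∉ ArrowsFrom.range '' {x | ε ≤ F x} := by
    rintro ⟨x, hx, rfl⟩
    rw [Set.mem_ofPred_eq, hFeq] at hx
    exact hc.not_ge hx
  filter_upwards [hC.isOpen_compl.mem_nhds hcC] with b hb
  by_cases h : Nonempty (a ⟶ b)
  · obtain ⟨x⟩ := h
    by_contra hlt
    exact hb ⟨⟨b, x⟩, by rw [Set.mem_ofPred_eq, hFeq]; exact not_lt.1 hlt, rfl⟩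
  · have := hρ b (not_nonempty_iff.1 h)
    rwa [Subsingleton.elim (transport π ρ V b (ξ b) - η b) 0, norm_zero]

end Transport

/-! ### Irreducible representations and their isotropy restrictions. -/

section Irreducible

variable {X : Type u} [Groupoid.{v} X] [TopologicalSpace X] [TopologicalSpace (Quiver.Total X)]
  [IsTopologicalGroupoid X] [CompactSpace (Quiver.Total X)] [T2Space X]
  {π ρ : Rep.{v, u, w} X}

open Classical in
/-- An irreducible representation is carried by one orbit. -/
theorem Rep.IsIrreducible.subsingleton_fiber (hπ : π.IsIrreducible) {a b : X}
    [Nontrivial (π.fiber a)] (h : IsEmpty (a ⟶ b)) : Subsingleton (π.fiber b) := by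
  -- The part of `π` off the orbit of `a`. It is not all of `π`, since the fibre over `a` is
  -- nonzero, so it must vanish.
  let K (c : X) : Submodule ℂ (π.fiber c) := if Nonempty (a ⟶ c) then ⊥ else ⊤
  have hbot {c : X} (hc : Nonempty (a ⟶ c)) : K c = ⊥ := if_pos hc
  have htop {c : X} (hc : ¬ Nonempty (a ⟶ c)) : K c = ⊤ := if_neg hc
  have hK : π.IsSubrep K := by
    refine ⟨fun c => ?_, fun {c d} x z hz => ?_, fun c z hz => ?_⟩
    · by_cases hc : Nonempty (a ⟶ c)
      · rw [hbot hc]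
        exact isClosed_singleton
      · rw [htop hc]
        exact isClosed_univ
    · by_cases hd : Nonempty (a ⟶ d)
      · have hc : Nonempty (a ⟶ c) := hd.map fun y => y ≫ Groupoid.inv x
        rw [hbot hc, Submodule.mem_bot] at hz
        simp [hz]
      · rw [htop hd]
        trivial
    · by_cases hc : Nonempty (a ⟶ c)
      · rw [hbot hc, Submodule.mem_bot] at hz
        exact subset_closure ⟨0, π.sections.zero_mem, fun b => (K b).zero_mem, hz.symm⟩
      · have := compactSpace_units X
        obtain ⟨f, hf0, hf1, -⟩ := exists_continuous_zero_one_of_isClosed (isClosed_orbit a)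
          (isClosed_singleton (x := c)) (Set.disjoint_singleton_right.2 hc)
        refine Metric.mem_closure_iff.2 fun ε hε => ?_
        obtain ⟨ξ, hξ, hz⟩ := π.exists_section_near z hε
        refine ⟨ξ c, ⟨fun b => (f b : ℂ) • ξ b, Rep.smul_mem_sections
          (Complex.continuous_ofReal.comp f.continuous) hξ, fun d => ?_, ?_⟩, ?_⟩
        · by_cases hd : Nonempty (a ⟶ d)
          · simp [hf0 hd]
          · rw [htop hd]
            trivial
        · simp [hf1 (Set.mem_singleton c)]
        · rwa [dist_eq_norm]
  have hb := htop (not_nonempty_iff.2 h)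
  rcases hπ.2 K hK with h0 | h1
  · exact (Submodule.subsingleton_iff ℂ).1 (subsingleton_of_bot_eq_top ((h0 b).symm.trans hb))
  · exact absurd ((hbot ⟨𝟙 a⟩).symm.trans (h1 a)) bot_ne_top

/-- The restriction of an irreducible representation to an isotropy group is irreducible. -/
theorem Rep.IsIrreducible.isotropy (hπ : π.IsIrreducible) {a : X} (L : Submodule ℂ (π.fiber a))
    (hL : IsClosed (L : Set (π.fiber a))) (hinv : ∀ (y : a ⟶ a), ∀ z ∈ L, π.op y z ∈ L) :
    L = ⊥ ∨ L = ⊤ := by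
  cases subsingleton_or_nontrivial (π.fiber a) with
  | inl _ => exact Or.inl (Subsingleton.elim _ _)
  | inr _ =>
  have : CompleteSpace L := hL.completeSpace_coe
  -- By unitarity the orthogonal complement of `L` is invariant too, so the projection onto `L`
  -- commutes with the isotropy.
  have hP : IsotropyIntertwining π π L.starProjection := fun y z => by
    refine Submodule.eq_starProjection_of_mem_of_inner_eq_zero
      (hinv y _ (L.starProjection_apply_mem z)) fun t ht => ?_
    rw [← map_sub, Rep.inner_op_left]
    exact L.starProjection_inner_eq_zero z _ (hinv _ _ ht)
  let P := transport π π L.starProjection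
  have hPP (b : X) (z : π.fiber b) : P b (P b z) = P b z := by
    by_cases h : Nonempty (a ⟶ b)
    · obtain ⟨x⟩ := h
      simp only [P, transport_apply hP x, Rep.op_inv_op]
      rw [Submodule.starProjection_eq_self_iff.2 (L.starProjection_apply_mem _)]
    · simp [P, transport_of_isEmpty (not_nonempty_iff.1 h)]
  -- The fixed vectors of the transported idempotent. Applying it to continuous sections of `π`
  -- yields enough continuous sections in `K`.
  let K (b : X) : Submodule ℂ (π.fiber b) := (P b - ContinuousLinearMap.id ℂ _).ker
  have hK' {b : X} {z : π.fiber b} : z ∈ K b ↔ P b z = z := by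
    simp [K, sub_eq_zero]
  have hK : π.IsSubrep K := by
    refine ⟨fun b => ContinuousLinearMap.isClosed_ker _, fun {b c} x z hz => ?_, fun b z hz => ?_⟩
    · rw [hK'] at hz ⊢
      exact (transport_op hP x z).trans (congrArg (π.op x) hz)
    · rw [hK'] at hz
      have h1 : z ∈ P b '' closure {y | ∃ ξ ∈ π.sections, ξ b = y} :=
        ⟨z, π.dense b z, hz⟩
      refine closure_mono ?_ (image_closure_subset_closure_image (P b).continuous h1)
      rintro _ ⟨_, ⟨ξ, hξ, rfl⟩, rfl⟩
      exact ⟨_, transport_mem_sections hP (fun c hc => hπ.subsingleton_fiber hc) hξ,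
        fun c => hK'.2 (hPP c _), rfl⟩
  have hKa : K a = L := by
    ext z
    rw [hK', show P a = _ from transport_self hP, Submodule.starProjection_eq_self_iff]
  rcases hπ.2 K hK with h | h
  · exact Or.inl (hKa ▸ h a)
  · exact Or.inr (hKa ▸ h a)

/-- Irreducible representations with equivalent restrictions to an isotropy group are
equivalent. -/
theorem Rep.IsIrreducible.unitaryEquiv_of_isotropy (hπ : π.IsIrreducible) (hρ : ρ.IsIrreducible)
    {a : X} [Nontrivial (π.fiber a)] (V : π.fiber a ≃ₗᵢ[ℂ] ρ.fiber a)
    (hV : ∀ (y : a ⟶ a) (z : π.fiber a), V (π.op y z) = ρ.op y (V z)) : π.UnitaryEquiv ρ := by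
  -- Nonzero fibres over `a` confine both representations to the orbit of `a`, where the transports
  -- of `V` and its inverse are mutually inverse.
  have : Nontrivial (ρ.fiber a) := V.symm.toEquiv.nontrivial
  let V₁ : π.fiber a →L[ℂ] ρ.fiber a := V.toContinuousLinearEquiv
  let V₂ : ρ.fiber a →L[ℂ] π.fiber a := V.symm.toContinuousLinearEquiv
  have hV1 : IsotropyIntertwining π ρ V₁ := hV
  have hV2 : IsotropyIntertwining ρ π V₂ := fun y z => by
    refine V.injective ?_
    change V (V.symm _) = V (π.op y (V.symm z))
    rw [hV]
    simp
  have h12 (b : X) (z : π.fiber b) : transport ρ π V₂ b (transport π ρ V₁ b z) = z := by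
    by_cases h : Nonempty (a ⟶ b)
    · obtain ⟨x⟩ := h
      rw [transport_apply hV1 x, transport_apply hV2 x]
      simp [V₁, V₂, -Groupoid.inv_eq_inv]
    · have := hπ.subsingleton_fiber (not_nonempty_iff.1 h)
      exact Subsingleton.elim _ _
  have h21 (b : X) (z : ρ.fiber b) : transport π ρ V₁ b (transport ρ π V₂ b z) = z := by
    by_cases h : Nonempty (a ⟶ b)
    · obtain ⟨x⟩ := h
      rw [transport_apply hV2 x, transport_apply hV1 x]
      simp [V₁, V₂, -Groupoid.inv_eq_inv]
    · have := hρ.subsingleton_fiber (not_nonempty_iff.1 h)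
      exact Subsingleton.elim _ _
  have hn (b : X) (z : π.fiber b) : ‖transport π ρ V₁ b z‖ = ‖z‖ := by
    by_cases h : Nonempty (a ⟶ b)
    · obtain ⟨x⟩ := h
      rw [transport_apply hV1 x]
      simp [V₁]
    · have := hπ.subsingleton_fiber (not_nonempty_iff.1 h)
      simp [Subsingleton.elim z 0]
  refine ⟨fun b =>
    { toLinearEquiv := LinearEquiv.ofLinearMap (transport π ρ V₁ b).toLinearMap
        (transport ρ π V₂ b).toLinearMap (LinearMap.ext (h21 b)) (LinearMap.ext (h12 b))
      norm_map' := hn b }, fun x z => transport_op hV1 x z, fun ξ => ⟨fun hξ => ?_, fun hξ => ?_⟩⟩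
  · exact transport_mem_sections hV1 (fun c hc => hρ.subsingleton_fiber hc) hξ
  · have h := transport_mem_sections hV2 (fun c hc => hπ.subsingleton_fiber hc) hξ
    convert h using 2 with b
    exact (h12 b _).symm

end Irreducible

/-! ### Invariance and positivity of the Haar system. -/

section Haar

variable {X : Type u} [Groupoid.{v} X] [TopologicalSpace (Quiver.Total X)]

instance (μ : NormalizedHaarSystem X) (a b : X) : (μ.measure a b).Regular := μ.regular a b

theorem NormalizedHaarSystem.isProbabilityMeasure (μ : NormalizedHaarSystem X) {a b : X}
    (h : Nonempty (a ⟶ b)) : IsProbabilityMeasure (μ.measure a b) :=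
  ⟨μ.normalized a b h⟩

variable [TopologicalSpace X] [IsTopologicalGroupoid X] [CompactSpace (Quiver.Total X)] [T2Space X]

theorem NormalizedHaarSystem.integrable (μ : NormalizedHaarSystem X) {a b : X} {E : Type*}
    [NormedAddCommGroup E] {f : (a ⟶ b) → E} (hf : Continuous f) :
    Integrable f (μ.measure a b) :=
  hf.integrable_of_hasCompactSupport (HasCompactSupport.of_compactSpace f)

theorem NormalizedHaarSystem.integral_comp (μ : NormalizedHaarSystem X) {a b c : X} {E : Type*}
    [NormedAddCommGroup E] [NormedSpace ℝ E] {f : (c ⟶ b) → E} (hf : Continuous f) (x : c ⟶ a) :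
    ∫ y, f (x ≫ y) ∂(μ.measure a b) = ∫ y, f y ∂(μ.measure c b) := by
  rw [← μ.right_invariant x, integral_map (continuous_comp_left x).aemeasurable]
  rw [μ.right_invariant x]
  exact (μ.integrable hf).aestronglyMeasurable

/-- Nonempty open sets have positive measure. -/
theorem NormalizedHaarSystem.isOpenPosMeasure (μ : NormalizedHaarSystem X) (a b : X) :
    (μ.measure a b).IsOpenPosMeasure := by
  refine ⟨fun U hU ⟨y, hy⟩ h0 => ?_⟩
  -- Translates of a null open set would cover the compact set `𝒢_a^b` by null sets, against total
  -- mass one.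
  have h1 : μ.measure a b Set.univ = 0 := by
    refine isCompact_univ.measure_zero_of_nhdsWithin fun z _ => ?_
    let x : a ⟶ a := y ≫ Groupoid.inv z
    refine ⟨(fun t => x ≫ t) ⁻¹' U, mem_nhdsWithin_of_mem_nhds
      ((hU.preimage (continuous_comp_left x)).mem_nhds ?_), ?_⟩
    · simpa [x] using hy
    · rw [← Measure.map_apply (continuous_comp_left x).measurable hU.measurableSet,
        μ.right_invariant x, h0]
  exact one_ne_zero ((μ.normalized a b ⟨y⟩).symm.trans h1)

end Haar

/-! ### Averaged rank one operators and finite dimensionality. -/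

section Averages

open InnerProductSpace

variable {X : Type u} [Groupoid.{v} X] [TopologicalSpace X] [TopologicalSpace (Quiver.Total X)]
  (μ : NormalizedHaarSystem X) (π ρ : Rep.{v, u, w} X)

/-- The average `∫ ρ(x⁻¹) |f⟩⟨e| π(x) dλ_a^b(x)` of a rank one operator. -/
def average (a : X) {b : X} (f : ρ.fiber b) (e : π.fiber b) : π.fiber a →L[ℂ] ρ.fiber a :=
  ∫ x : a ⟶ b, rankOne ℂ (ρ.op (Groupoid.inv x) f) (π.op (Groupoid.inv x) e) ∂(μ.measure a b)

variable {a b : X} {π ρ} [IsTopologicalGroupoid X]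

theorem continuous_rankOne_op_inv (f : ρ.fiber b) (e : π.fiber b) :
    Continuous fun x : a ⟶ b =>
      rankOne ℂ (ρ.op (Groupoid.inv x) f) (π.op (Groupoid.inv x) e) :=
  ((ContinuousLinearMap.smulRightL ℂ (π.fiber a) (ρ.fiber a)).continuous.comp
    ((innerSL ℂ).continuous.comp (Rep.continuous_op_inv e))).clm_apply (Rep.continuous_op_inv f)

variable [CompactSpace (Quiver.Total X)] [T2Space X]

theorem average_apply (f : ρ.fiber b) (e : π.fiber b) (z : π.fiber a) :
    average μ π ρ a f e z =
      ∫ x : a ⟶ b, inner ℂ e (π.op x z) • ρ.op (Groupoid.inv x) f ∂(μ.measure a b) := by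
  rw [average, ContinuousLinearMap.integral_apply (μ.integrable (continuous_rankOne_op_inv f e))]
  refine integral_congr_ae (Filter.Eventually.of_forall fun x => ?_)
  simp only [rankOne_apply]
  rw [← (π.op x).inner_map_map, π.op_op_inv]

/-- Right translation by `y` replaces `π(x)` by `π(x) π(y)` and `ρ(x⁻¹)` by `ρ(y⁻¹) ρ(x⁻¹)`;
invariance of the measure does the rest. -/
theorem isotropyIntertwining_average (f : ρ.fiber b) (e : π.fiber b) :
    IsotropyIntertwining π ρ (average μ π ρ a f e) := fun y z => by
  have hc : Continuous fun x : a ⟶ b => inner ℂ e (π.op x z) • ρ.op (Groupoid.inv x) f :=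
    (continuous_const.inner (Rep.continuous_op z)).smul (Rep.continuous_op_inv f)
  have h := (ρ.op y).toContinuousLinearEquiv.toContinuousLinearMap.integral_comp_comm
    (μ.integrable hc)
  rw [average_apply, average_apply]
  refine Eq.trans ?_ ((μ.integral_comp ((ρ.op y).continuous.comp hc) y).trans h)
  refine integral_congr_ae (Filter.Eventually.of_forall fun x => ?_)
  simp only [Function.comp_apply, map_smul, π.op_mul]
  rw [← ρ.op_mul]
  simp [Groupoid.inv_eq_inv]

theorem isCompactOperator_rankOne {E F : Type*} [NormedAddCommGroup E] [InnerProductSpace ℂ E]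
    [NormedAddCommGroup F] [InnerProductSpace ℂ F] (z : E) (y : F) :
    IsCompactOperator (rankOne ℂ z y) :=
  ((isCompactOperator_id (E := ℂ)).continuous_comp
    (ContinuousLinearMap.toSpanSingleton ℂ z).continuous).comp_clm (innerSL ℂ y)

/-- The fibres of an irreducible representation are finite dimensional. -/
theorem Rep.IsIrreducible.finiteDimensional (hπ : π.IsIrreducible)
    (μ : NormalizedHaarSystem X) (a : X) : FiniteDimensional ℂ (π.fiber a) := by
  cases subsingleton_or_nontrivial (π.fiber a) with
  | inl _ => infer_instance
  | inr _ =>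
  obtain ⟨z, hz⟩ := exists_ne (0 : π.fiber a)
  let A := average μ π π a z z
  have : IsProbabilityMeasure (μ.measure a a) := μ.isProbabilityMeasure ⟨𝟙 a⟩
  have hcomp : IsCompactOperator A := by
    -- Compact operators form a closed convex set, which contains averages over a probability
    -- measure. The same argument gives self-adjointness.
    have h : A ∈ (compactOperator (RingHom.id ℂ) (π.fiber a) (π.fiber a) :
        Set (π.fiber a →L[ℂ] π.fiber a)) :=
      ((compactOperator (RingHom.id ℂ) (π.fiber a) (π.fiber a)).restrictScalars
        ℝ).convex.integral_mem isClosed_setOfPred_isCompactOperator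
        (Filter.Eventually.of_forall fun x => isCompactOperator_rankOne _ _)
        (μ.integrable (continuous_rankOne_op_inv z z))
    exact h
  have hself : IsSelfAdjoint A :=
    (selfAdjoint.submodule ℝ (π.fiber a →L[ℂ] π.fiber a)).convex.integral_mem
      (isClosed_eq continuous_star continuous_id)
      (Filter.Eventually.of_forall fun x =>
        ContinuousLinearMap.isSelfAdjoint_iff'.2 (adjoint_rankOne _ _))
      (μ.integrable (continuous_rankOne_op_inv z z))
  -- `⟨z, A z⟩` is the integral of `|⟨z, π(x) z⟩|²`, a continuous function that is positive at the
  -- unit.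
  have hA : A ≠ 0 := fun h0 => by
    have := μ.isOpenPosMeasure a a
    have hc : Continuous fun x : a ⟶ a => ‖inner ℂ z (π.op x z)‖ ^ 2 :=
      ((continuous_const.inner (Rep.continuous_op z)).norm).pow 2
    have hpos := hc.integral_pos_of_hasCompactSupport_nonneg_nonzero (μ := μ.measure a a)
      (x := 𝟙 a) (HasCompactSupport.of_compactSpace _) (fun x => sq_nonneg _)
      (by simpa [π.op_unit] using hz)
    have hin : inner ℂ z (A z) =
        ((∫ x : a ⟶ a, ‖inner ℂ z (π.op x z)‖ ^ 2 ∂(μ.measure a a) : ℝ) : ℂ) := by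
      have hc' : Continuous fun x : a ⟶ a => inner ℂ z (π.op x z) • π.op (Groupoid.inv x) z :=
        (continuous_const.inner (Rep.continuous_op z)).smul (Rep.continuous_op_inv z)
      have h := (innerSL ℂ z).integral_comp_comm (μ.integrable hc')
      rw [← integral_complex_ofReal, average_apply]
      refine h.symm.trans (integral_congr_ae (Filter.Eventually.of_forall fun x => ?_))
      simp only [innerSL_apply_apply, inner_smul_right]
      rw [← Rep.inner_op_left, ← inner_conj_symm (π.op x z), Complex.mul_conj,
        Complex.normSq_eq_norm_sq]
    rw [h0] at hin
    simp only [zero_apply, inner_zero_right] at hin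
    exact hpos.ne (by exact_mod_cast hin)
  -- The spectral theorem gives a nonzero eigenvalue. Its eigenspace is finite dimensional and
  -- isotropy invariant, hence the whole fibre.
  have hev := (ContinuousLinearMap.eq_zero_of_forall_hasEigenvalue_eq_zero hcomp
    (ContinuousLinearMap.isSelfAdjoint_iff_isSymmetric.1 hself)).not.2 hA
  push Not at hev
  obtain ⟨t, ht, ht0⟩ := hev
  have hfin := ContinuousLinearMap.finite_dimensional_eigenspace hcomp t ht0
  rcases hπ.isotropy (Module.End.eigenspace (A : Module.End ℂ (π.fiber a)) t)
    (Submodule.closed_of_finiteDimensional _) fun y z hz => by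
      rw [Module.End.mem_eigenspace_iff] at hz ⊢
      exact (isotropyIntertwining_average μ _ _ y z).trans
        ((congrArg (π.op y) hz).trans (map_smul _ _ _)) with h | h
  · exact absurd h ht
  · rw [h] at hfin
    exact Module.finite_def.2 ((Submodule.fg_top _).1 hfin.1)

end Averages

/-! ### Schur's lemma and the value of the averages. -/

section Schur

open InnerProductSpace

variable {X : Type u} [Groupoid.{v} X] [TopologicalSpace X] [TopologicalSpace (Quiver.Total X)]
  {π ρ : Rep.{v, u, w} X} {a b : X}

theorem IsotropyIntertwining.adjoint {V : π.fiber a →L[ℂ] ρ.fiber a}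
    (hV : IsotropyIntertwining π ρ V) :
    IsotropyIntertwining ρ π (ContinuousLinearMap.adjoint V) := fun y z => by
  refine ext_inner_right ℂ fun t => ?_
  rw [ContinuousLinearMap.adjoint_inner_left, Rep.inner_op_left, Rep.inner_op_left, ← hV,
    ContinuousLinearMap.adjoint_inner_left]

theorem IsotropyIntertwining.comp {τ : Rep.{v, u, w} X} {V : π.fiber a →L[ℂ] ρ.fiber a}
    {W : ρ.fiber a →L[ℂ] τ.fiber a} (hW : IsotropyIntertwining ρ τ W)
    (hV : IsotropyIntertwining π ρ V) : IsotropyIntertwining π τ (W.comp V) := fun y z => by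
  simp only [ContinuousLinearMap.comp_apply, hV y, hW y]

theorem Rep.finrank_eq (π : Rep.{v, u, w} X) (x : a ⟶ b) :
    Module.finrank ℂ (π.fiber a) = Module.finrank ℂ (π.fiber b) :=
  (π.op x).toLinearEquiv.finrank_eq

theorem Rep.adjoint_opCLM (π : Rep.{v, u, w} X) (x : a ⟶ b) :
    ContinuousLinearMap.adjoint (π.opCLM x) = π.opCLM (Groupoid.inv x) := by
  ext z
  refine ext_inner_left ℂ fun t => ?_
  rw [ContinuousLinearMap.adjoint_inner_right, Rep.opCLM_apply, Rep.opCLM_apply,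
    Rep.inner_op_left]

variable [IsTopologicalGroupoid X] [CompactSpace (Quiver.Total X)] [T2Space X]

/-- **Schur's lemma**: isotropy intertwining operators of an irreducible representation are
scalar. -/
theorem Rep.IsIrreducible.exists_eq_smul_id (hπ : π.IsIrreducible)
    [FiniteDimensional ℂ (π.fiber a)] {V : π.fiber a →L[ℂ] π.fiber a}
    (hV : IsotropyIntertwining π π V) : ∃ t : ℂ, V = t • ContinuousLinearMap.id ℂ _ := by
  cases subsingleton_or_nontrivial (π.fiber a) with
  | inl _ => exact ⟨0, ContinuousLinearMap.ext fun z => Subsingleton.elim _ _⟩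
  | inr _ =>
  obtain ⟨t, ht⟩ := Module.End.exists_eigenvalue (V : Module.End ℂ (π.fiber a))
  rcases hπ.isotropy (Module.End.eigenspace (V : Module.End ℂ (π.fiber a)) t)
    (Submodule.closed_of_finiteDimensional _) fun y z hz => by
      rw [Module.End.mem_eigenspace_iff] at hz ⊢
      exact (hV y z).trans ((congrArg (π.op y) hz).trans (map_smul _ _ _)) with h | h
  · exact absurd h ht
  · refine ⟨t, ContinuousLinearMap.ext fun z => ?_⟩
    exact Module.End.mem_eigenspace_iff.1 (h ▸ Submodule.mem_top (x := z))

/-- **Schur's lemma**: there are no isotropy intertwining operators between inequivalent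
irreducible representations. -/
theorem Rep.IsIrreducible.eq_zero_of_not_unitaryEquiv (hπ : π.IsIrreducible)
    (hρ : ρ.IsIrreducible) (hne : ¬ π.UnitaryEquiv ρ) [FiniteDimensional ℂ (π.fiber a)]
    [FiniteDimensional ℂ (ρ.fiber a)] {V : π.fiber a →L[ℂ] ρ.fiber a}
    (hV : IsotropyIntertwining π ρ V) : V = 0 := by
  by_contra hV0
  -- `V* V` is scalar, so `V` is a positive multiple of an isometry. The range of that isometry is
  -- invariant, so it is a unitary equivalence over `a`, which extends to the whole field.
  obtain ⟨t, ht⟩ := hπ.exists_eq_smul_id (hV.adjoint.comp hV)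
  have hVt (z : π.fiber a) : ((‖V z‖ ^ 2 : ℝ) : ℂ) = t * ((‖z‖ ^ 2 : ℝ) : ℂ) := by
    have h : inner ℂ z ((ContinuousLinearMap.adjoint V).comp V z) = t * inner ℂ z z := by
      rw [ht]
      simp
    rw [ContinuousLinearMap.comp_apply, ContinuousLinearMap.adjoint_inner_right,
      inner_self_eq_norm_sq_to_K, inner_self_eq_norm_sq_to_K] at h
    exact_mod_cast h
  obtain ⟨z, hz⟩ : ∃ z, V z ≠ 0 := by
    by_contra! h
    exact hV0 (ContinuousLinearMap.ext h)
  have hz0 : z ≠ 0 := fun h => hz (by rw [h, map_zero])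
  have : Nontrivial (π.fiber a) := ⟨z, 0, hz0⟩
  obtain ⟨r, hr, hVr⟩ : ∃ r : ℝ, 0 < r ∧ ∀ z, ‖V z‖ = r * ‖z‖ := by
    have hre (z : π.fiber a) : ‖V z‖ ^ 2 = t.re * ‖z‖ ^ 2 := by
      have h := congrArg Complex.re (hVt z)
      rwa [Complex.ofReal_re, Complex.re_mul_ofReal] at h
    have htre : 0 < t.re := by
      have h1 : 0 < ‖V z‖ ^ 2 := by positivity
      rw [hre z] at h1
      exact pos_of_mul_pos_left h1 (sq_nonneg _)
    refine ⟨√t.re, Real.sqrt_pos.2 htre, fun z => ?_⟩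
    rw [← Real.sqrt_sq (norm_nonneg (V z)), hre, Real.sqrt_mul htre.le,
      Real.sqrt_sq (norm_nonneg z)]
  let U : π.fiber a →ₗᵢ[ℂ] ρ.fiber a :=
    { toLinearMap := ((r⁻¹ : ℝ) : ℂ) • V.toLinearMap
      norm_map' := fun z => by
        simp only [LinearMap.smul_apply, ContinuousLinearMap.coe_coe, norm_smul,
          Complex.norm_real, Real.norm_eq_abs, abs_of_pos (inv_pos.2 hr), hVr]
        field_simp }
  have hU (z : π.fiber a) : U z = ((r⁻¹ : ℝ) : ℂ) • V z := rfl
  have hUy (y : a ⟶ a) (z : π.fiber a) : U (π.op y z) = ρ.op y (U z) := by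
    rw [hU, hU, hV y z, map_smul]
  have hsurj : Function.Surjective U := by
    rcases hρ.isotropy U.toLinearMap.range (Submodule.closed_of_finiteDimensional _) fun y t ht => by
      obtain ⟨s, rfl⟩ := ht
      exact ⟨π.op y s, hUy y s⟩ with h | h
    · have h1 : U z = 0 := by
        have : U z ∈ U.toLinearMap.range := ⟨z, rfl⟩
        rwa [h, Submodule.mem_bot] at this
      exact absurd (norm_eq_zero.1 (by rw [← U.norm_map, h1, norm_zero])) hz0
    · exact LinearMap.range_eq_top.1 h
  exact hne (hπ.unitaryEquiv_of_isotropy hρ (LinearIsometryEquiv.ofSurjective U hsurj) hUy)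

/-- If an irreducible representation has a nonzero operator between two fibres, then these lie
over the same orbit. -/
theorem Rep.IsIrreducible.nonempty_hom (hπ : π.IsIrreducible) {h : π.fiber b →L[ℂ] π.fiber a}
    (h0 : h ≠ 0) : Nonempty (a ⟶ b) := by
  obtain ⟨z, hz⟩ : ∃ z, h z ≠ 0 := by
    by_contra! h'
    exact h0 (ContinuousLinearMap.ext h')
  have : Nontrivial (π.fiber a) := ⟨h z, 0, hz⟩
  by_contra hne
  have := hπ.subsingleton_fiber (not_nonempty_iff.1 hne)
  exact hz (by rw [Subsingleton.elim z 0, map_zero])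

variable (μ : NormalizedHaarSystem X)

theorem average_of_not_unitaryEquiv (hπ : π.IsIrreducible) (hρ : ρ.IsIrreducible)
    (hne : ¬ π.UnitaryEquiv ρ) (f : ρ.fiber b) (e : π.fiber b) :
    average μ π ρ a f e = 0 := by
  have := hπ.finiteDimensional μ a
  have := hρ.finiteDimensional μ a
  exact hπ.eq_zero_of_not_unitaryEquiv hρ hne (isotropyIntertwining_average μ f e)

/-- The trace of an operator valued integral. -/
theorem trace_comp_integral {E F : Type*} [NormedAddCommGroup E] [InnerProductSpace ℂ E]
    [FiniteDimensional ℂ E] [NormedAddCommGroup F] [InnerProductSpace ℂ F]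
    [FiniteDimensional ℂ F] {S : Type*} [MeasurableSpace S] {ν : Measure S} {g : S → E →L[ℂ] F}
    (hg : Integrable g ν) (K : F →L[ℂ] E) :
    LinearMap.trace ℂ E (K.comp (∫ x, g x ∂ν)).toLinearMap =
      ∫ x, LinearMap.trace ℂ E (K.comp (g x)).toLinearMap ∂ν := by
  let φ : (E →L[ℂ] F) →L[ℂ] ℂ := ∑ i, (innerSL ℂ (stdOrthonormalBasis ℂ E i)).comp
    (K.comp (ContinuousLinearMap.apply ℂ F (stdOrthonormalBasis ℂ E i)))
  have hφ (T : E →L[ℂ] F) : LinearMap.trace ℂ E (K.comp T).toLinearMap = φ T := by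
    rw [LinearMap.trace_eq_sum_inner _ (stdOrthonormalBasis ℂ E)]
    simp [φ]
  have := FiniteDimensional.complete ℂ E
  have := FiniteDimensional.complete ℂ F
  simp only [hφ]
  exact (φ.integral_comp_comm hg).symm

/-- The trace of a product does not depend on the order. -/
theorem trace_comp_comm {E F : Type*} [NormedAddCommGroup E] [InnerProductSpace ℂ E]
    [FiniteDimensional ℂ E] [NormedAddCommGroup F] [InnerProductSpace ℂ F]
    [FiniteDimensional ℂ F] (S : E →L[ℂ] F) (T : F →L[ℂ] E) :
    LinearMap.trace ℂ E (T.comp S).toLinearMap = LinearMap.trace ℂ F (S.comp T).toLinearMap :=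
  LinearMap.trace_comp_comm' S.toLinearMap T.toLinearMap

theorem trace_adjoint {E : Type*} [NormedAddCommGroup E] [InnerProductSpace ℂ E]
    [FiniteDimensional ℂ E] [CompleteSpace E] (T : E →L[ℂ] E) :
    LinearMap.trace ℂ E (ContinuousLinearMap.adjoint T).toLinearMap =
      starRingEnd ℂ (LinearMap.trace ℂ E T.toLinearMap) := by
  simp only [LinearMap.trace_eq_sum_inner _ (stdOrthonormalBasis ℂ E), map_sum,
    ContinuousLinearMap.coe_coe, ContinuousLinearMap.adjoint_inner_right, inner_conj_symm]

theorem continuous_trace {S E : Type*} [TopologicalSpace S] [NormedAddCommGroup E]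
    [InnerProductSpace ℂ E] [FiniteDimensional ℂ E] {F : S → E →L[ℂ] E}
    (hF : ∀ z, Continuous fun x => F x z) :
    Continuous fun x => LinearMap.trace ℂ E (F x).toLinearMap := by
  simp only [LinearMap.trace_eq_sum_inner _ (stdOrthonormalBasis ℂ E)]
  exact continuous_finsetSum _ fun i _ => continuous_const.inner (hF _)

/-- The average is a scalar by Schur's lemma, and every operator being averaged has trace `⟨e, f⟩`.
Keeping the dimension as a factor on the left also covers zero fibres. -/
theorem finrank_smul_average (hπ : π.IsIrreducible) (f e : π.fiber b) :
    (Module.finrank ℂ (π.fiber a) : ℂ) • average μ π π a f e =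
      (inner ℂ e f : ℂ) • ContinuousLinearMap.id ℂ (π.fiber a) := by
  have := hπ.finiteDimensional μ a
  cases subsingleton_or_nontrivial (π.fiber a) with
  | inl _ => exact ContinuousLinearMap.ext fun z => Subsingleton.elim _ _
  | inr _ =>
  by_cases hab : Nonempty (a ⟶ b)
  · have := μ.isProbabilityMeasure hab
    obtain ⟨t, ht⟩ := hπ.exists_eq_smul_id (isotropyIntertwining_average μ (a := a) f e)
    have htr : LinearMap.trace ℂ (π.fiber a) (average μ π π a f e).toLinearMap = inner ℂ e f := by
      have h := trace_comp_integral (μ.integrable (continuous_rankOne_op_inv (a := a) f e))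
        (ContinuousLinearMap.id ℂ (π.fiber a))
      simp only [ContinuousLinearMap.id_comp] at h
      rw [average, h]
      have h1 (x : a ⟶ b) : LinearMap.trace ℂ (π.fiber a) (rankOne ℂ (π.op (Groupoid.inv x) f)
          (π.op (Groupoid.inv x) e)).toLinearMap = inner ℂ e f := by
        rw [trace_rankOne, (π.op _).inner_map_map]
      simp only [h1]
      simp
    have htr' := htr
    rw [ht] at htr'
    have h2 : t * Module.finrank ℂ (π.fiber a) = inner ℂ e f := by
      rw [← htr']
      simp
    rw [ht, smul_smul, mul_comm, h2]
  · have := hπ.subsingleton_fiber (not_nonempty_iff.1 hab)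
    have h0 : average μ π π a f e = 0 := by
      rw [Subsingleton.elim f 0]
      simp [average]
    rw [h0, Subsingleton.elim f 0]
    simp

end Schur

/-! ### Orthogonality relations. -/

section Coefficients

variable {X : Type u} [Groupoid.{v} X] [TopologicalSpace X] [TopologicalSpace (Quiver.Total X)]
  [IsTopologicalGroupoid X]
  {π ρ : Rep.{v, u, w} X} {a b : X}

theorem Rep.continuous_opCLM [FiniteDimensional ℂ (π.fiber a)] :
    Continuous fun x : a ⟶ b => π.opCLM x :=
  continuous_clm_apply.2 fun z => Rep.continuous_op z

theorem Rep.continuous_opCLM_inv [FiniteDimensional ℂ (π.fiber b)] :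
    Continuous fun x : a ⟶ b => π.opCLM (Groupoid.inv x) :=
  continuous_clm_apply.2 fun z => Rep.continuous_op_inv z

theorem Rep.continuous_trace_comp_opCLM [FiniteDimensional ℂ (π.fiber a)]
    (h : π.fiber b →L[ℂ] π.fiber a) : Continuous fun x : a ⟶ b =>
      LinearMap.trace ℂ (π.fiber a) (h.comp (π.opCLM x)).toLinearMap :=
  continuous_trace fun z => h.continuous.comp (Rep.continuous_op z)

variable [CompactSpace (Quiver.Total X)] [T2Space X] (μ : NormalizedHaarSystem X)

/-- The Fourier coefficient of a coefficient function as a sum of averages. -/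
theorem integral_trace_smul_op_inv [FiniteDimensional ℂ (π.fiber a)]
    [FiniteDimensional ℂ (π.fiber b)] [FiniteDimensional ℂ (ρ.fiber b)]
    (h : π.fiber b →L[ℂ] π.fiber a) (e : ρ.fiber b) :
    (∫ x : a ⟶ b, LinearMap.trace ℂ (π.fiber a) (h.comp (π.opCLM x)).toLinearMap •
      ρ.opCLM (Groupoid.inv x) ∂(μ.measure a b)) e =
    ∑ i, average μ π ρ a e (stdOrthonormalBasis ℂ (π.fiber b) i)
      (h (stdOrthonormalBasis ℂ (π.fiber b) i)) := by
  have hc : Continuous fun x : a ⟶ b => LinearMap.trace ℂ (π.fiber a)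
      (h.comp (π.opCLM x)).toLinearMap • ρ.opCLM (Groupoid.inv x) :=
    (Rep.continuous_trace_comp_opCLM h).smul Rep.continuous_opCLM_inv
  rw [ContinuousLinearMap.integral_apply (μ.integrable hc)]
  simp only [average_apply]
  have hc' (i) : Continuous fun x : a ⟶ b => inner ℂ (stdOrthonormalBasis ℂ (π.fiber b) i)
      (π.op x (h (stdOrthonormalBasis ℂ (π.fiber b) i))) • ρ.op (Groupoid.inv x) e :=
    (continuous_const.inner (Rep.continuous_op _)).smul (Rep.continuous_op_inv e)
  rw [← integral_finsetSum _ fun i _ => μ.integrable (hc' i)]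
  refine integral_congr_ae (Filter.Eventually.of_forall fun x => ?_)
  simp only [smul_apply, Rep.opCLM_apply, ← Finset.sum_smul]
  -- Cyclicity moves the trace to the fibre over `b`, where it becomes a sum of terms `⟨eᵢ, π(x) h
  -- eᵢ⟩`.
  rw [trace_comp_comm, LinearMap.trace_eq_sum_inner _ (stdOrthonormalBasis ℂ (π.fiber b))]
  rfl

/-- Pairing with `f` turns `ρ(x) z` into the scalar `⟨f, ρ(x) z⟩`, so the same averages appear with
`π` and `ρ` exchanged. Thus right invariance suffices for this orientation as well. -/
theorem inner_integral_trace_smul_op [FiniteDimensional ℂ (π.fiber a)]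
    [FiniteDimensional ℂ (π.fiber b)] [FiniteDimensional ℂ (ρ.fiber a)]
    (k : π.fiber a →L[ℂ] π.fiber b) (f : ρ.fiber b) (z : ρ.fiber a) :
    inner ℂ f ((∫ x : a ⟶ b, LinearMap.trace ℂ (π.fiber b)
      (k.comp (π.opCLM (Groupoid.inv x))).toLinearMap • ρ.opCLM x ∂(μ.measure a b)) z) =
    ∑ i, inner ℂ (stdOrthonormalBasis ℂ (π.fiber b) i)
      (k (average μ ρ π a (stdOrthonormalBasis ℂ (π.fiber b) i) f z)) := by
  have hc : Continuous fun x : a ⟶ b => LinearMap.trace ℂ (π.fiber b)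
      (k.comp (π.opCLM (Groupoid.inv x))).toLinearMap :=
    (Rep.continuous_trace_comp_opCLM k).comp (continuous_groupoid_inv a b)
  have hc' (i) : Continuous fun x : a ⟶ b => inner ℂ f (ρ.op x z) • π.op (Groupoid.inv x)
      (stdOrthonormalBasis ℂ (π.fiber b) i) :=
    (continuous_const.inner (Rep.continuous_op z)).smul (Rep.continuous_op_inv _)
  have hc'' : Continuous fun x : a ⟶ b => LinearMap.trace ℂ (π.fiber b)
      (k.comp (π.opCLM (Groupoid.inv x))).toLinearMap • ρ.opCLM x :=
    hc.smul Rep.continuous_opCLM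
  rw [ContinuousLinearMap.integral_apply (μ.integrable hc'')]
  have hcz : Continuous fun x : a ⟶ b => LinearMap.trace ℂ (π.fiber b)
      (k.comp (π.opCLM (Groupoid.inv x))).toLinearMap • ρ.op x z :=
    hc.smul (Rep.continuous_op z)
  have h1 := (innerSL ℂ f).integral_comp_comm (μ.integrable hcz)
  have h2 (i) := ((innerSL ℂ (stdOrthonormalBasis ℂ (π.fiber b) i)).comp k).integral_comp_comm
    (μ.integrable (hc' i))
  refine h1.symm.trans ?_
  simp only [average_apply]
  refine Eq.trans ?_ (Finset.sum_congr rfl fun i _ => h2 i)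
  have hk (i) : Continuous fun x : a ⟶ b =>
      (innerSL ℂ (stdOrthonormalBasis ℂ (π.fiber b) i)).comp k
        (inner ℂ f (ρ.op x z) • π.op (Groupoid.inv x) (stdOrthonormalBasis ℂ (π.fiber b) i)) :=
    ((innerSL ℂ (stdOrthonormalBasis ℂ (π.fiber b) i)).comp k).continuous.comp (hc' i)
  rw [← integral_finsetSum _ fun i _ => μ.integrable (hk i)]
  refine integral_congr_ae (Filter.Eventually.of_forall fun x => ?_)
  simp only [map_smul, smul_eq_mul, ← Finset.mul_sum, innerSL_apply_apply,
    ContinuousLinearMap.comp_apply]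
  rw [LinearMap.trace_eq_sum_inner _ (stdOrthonormalBasis ℂ (π.fiber b)), mul_comm]
  rfl

variable (hπ : π.IsIrreducible) (hρ : ρ.IsIrreducible)
include hπ

/-- Orthogonality relations for equal irreducible representations. -/
theorem finrank_smul_integral_trace_smul_op_inv (h : π.fiber b →L[ℂ] π.fiber a) :
    (Module.finrank ℂ (π.fiber a) : ℂ) •
      ∫ x : a ⟶ b, LinearMap.trace ℂ (π.fiber a) (h.comp (π.opCLM x)).toLinearMap •
        π.opCLM (Groupoid.inv x) ∂(μ.measure a b) = h := by
  have := hπ.finiteDimensional μ a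
  have := hπ.finiteDimensional μ b
  ext e
  rw [smul_apply, integral_trace_smul_op_inv, Finset.smul_sum]
  simp only [← smul_apply, finrank_smul_average μ hπ]
  simp only [smul_apply, ContinuousLinearMap.id_apply, ← map_smul, ← map_sum,
    OrthonormalBasis.sum_repr']

/-- Orthogonality relations for equal irreducible representations. -/
theorem finrank_smul_integral_trace_smul_op (k : π.fiber a →L[ℂ] π.fiber b) :
    (Module.finrank ℂ (π.fiber b) : ℂ) •
      ∫ x : a ⟶ b, LinearMap.trace ℂ (π.fiber b)
        (k.comp (π.opCLM (Groupoid.inv x))).toLinearMap • π.opCLM x ∂(μ.measure a b) = k := by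
  have := hπ.finiteDimensional μ a
  have := hπ.finiteDimensional μ b
  by_cases hab : Nonempty (a ⟶ b)
  · obtain ⟨x⟩ := hab
    -- The averages live over `a` and carry its dimension; an arrow identifies it with the dimension
    -- over `b`.
    rw [← π.finrank_eq x]
    ext z
    refine ext_inner_left ℂ fun f => ?_
    have key (e : π.fiber b) : (Module.finrank ℂ (π.fiber a) : ℂ) *
        inner ℂ e (k (average μ π π a e f z)) = inner ℂ f e * inner ℂ e (k z) := by
      rw [← inner_smul_right, ← map_smul, ← smul_apply, finrank_smul_average μ hπ, smul_apply,
        ContinuousLinearMap.id_apply, map_smul, inner_smul_right]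
    rw [smul_apply, inner_smul_right, inner_integral_trace_smul_op, Finset.mul_sum]
    simp only [key, OrthonormalBasis.sum_inner_mul_inner]
  -- Without arrows one of the two fibres is zero, and so is every operator between them.
  · have h0 (T : π.fiber a →L[ℂ] π.fiber b) : T = 0 := by
      by_contra hT
      exact hab ((hπ.nonempty_hom hT).map Groupoid.inv)
    rw [h0 k]
    exact h0 _

include hρ

/-- Orthogonality relations for inequivalent irreducible representations. -/
theorem integral_trace_smul_op_inv_eq_zero (hne : ¬ π.UnitaryEquiv ρ)
    (h : π.fiber b →L[ℂ] π.fiber a) :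
    ∫ x : a ⟶ b, LinearMap.trace ℂ (π.fiber a) (h.comp (π.opCLM x)).toLinearMap •
      ρ.opCLM (Groupoid.inv x) ∂(μ.measure a b) = 0 := by
  have := hπ.finiteDimensional μ a
  have := hπ.finiteDimensional μ b
  have := hρ.finiteDimensional μ b
  ext e
  rw [integral_trace_smul_op_inv]
  simp [average_of_not_unitaryEquiv μ hπ hρ hne]

/-- Orthogonality relations for inequivalent irreducible representations. -/
theorem integral_trace_smul_op_eq_zero (hne : ¬ π.UnitaryEquiv ρ)
    (k : π.fiber a →L[ℂ] π.fiber b) :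
    ∫ x : a ⟶ b, LinearMap.trace ℂ (π.fiber b)
      (k.comp (π.opCLM (Groupoid.inv x))).toLinearMap • ρ.opCLM x ∂(μ.measure a b) = 0 := by
  have := hπ.finiteDimensional μ a
  have := hπ.finiteDimensional μ b
  have := hρ.finiteDimensional μ a
  ext z
  refine ext_inner_left ℂ fun f => ?_
  rw [inner_integral_trace_smul_op]
  simp [average_of_not_unitaryEquiv μ hρ hπ fun h => hne h.symm]

end Coefficients

/-! ### Inversion, products, adjoints and inner products. -/

section Fourier

variable {X : Type u} [Groupoid.{v} X] [TopologicalSpace X] [TopologicalSpace (Quiver.Total X)]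
  {σ : Selection.{v, u, w} X} {a b d : X}

theorem Selection.isIrreducible (σ : Selection.{v, u, w} X) (c : Dual.{v, u, w} X) :
    (σ.rep c).IsIrreducible := (σ.irr c).2

theorem Selection.not_unitaryEquiv (σ : Selection.{v, u, w} X) {c c' : Dual.{v, u, w} X}
    (h : c ≠ c') : ¬ (σ.rep c).UnitaryEquiv (σ.rep c') := fun h' => by
  refine h ?_
  rw [← σ.mk_irr c, ← σ.mk_irr c']
  exact Quotient.sound h'

theorem OpSum.exists_finset (h : OpSum σ a b) :
    ∃ s : Finset (Dual.{v, u, w} X), ∀ c ∉ s, h c = 0 := by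
  refine ⟨h.finite_support.toFinset, fun c hc => ?_⟩
  by_contra h0
  exact hc (h.finite_support.mem_toFinset.2 h0)

@[simp]
theorem OpSum.mul_apply (h : OpSum σ b a) (k : OpSum σ d b) (c : Dual.{v, u, w} X) :
    h.mul k c = (h c).comp (k c) :=
  DFinsupp.zipWith_apply _ _ _ _ _

@[simp]
theorem OpSum.star_apply (h : OpSum σ a b) (c : Dual.{v, u, w} X) :
    h.star c = ContinuousLinearMap.adjoint (h c) :=
  DFinsupp.mapRange_apply _ _ _ _

theorem finsum_eq_sum_of_forall_notMem {ι M : Type*} [AddCommMonoid M] {f : ι → M} {s : Finset ι}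
    (hs : ∀ i ∉ s, f i = 0) : ∑ᶠ i, f i = ∑ i ∈ s, f i :=
  finsum_eq_sum_of_support_subset f fun i hi => by
    by_contra his
    exact hi (hs i his)

theorem invFourier_eq_sum {h : OpSum σ b a} {s : Finset (Dual.{v, u, w} X)}
    (hs : ∀ c ∉ s, h c = 0) (x : a ⟶ b) :
    invFourier σ h x = ∑ c ∈ s, (σ.dim c a : ℂ) *
      LinearMap.trace ℂ (σ.fib c a) ((h c).comp (σ.op c x)).toLinearMap :=
  finsum_eq_sum_of_forall_notMem fun c hc => by simp [hs c hc]

theorem invFourierOp_eq (h : OpSum σ b a) (x : b ⟶ a) :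
    invFourierOp σ h x = invFourier σ h (Groupoid.inv x) := rfl

theorem OpSum.ip_eq_sum {h k : OpSum σ b a} {s : Finset (Dual.{v, u, w} X)}
    (hs : ∀ c ∉ s, h c = 0) : h.ip k = ∑ c ∈ s, (σ.dim c a : ℂ) *
      LinearMap.trace ℂ (σ.fib c b)
        ((ContinuousLinearMap.adjoint (h c)).comp (k c)).toLinearMap :=
  finsum_eq_sum_of_forall_notMem fun c hc => by simp [hs c hc]

theorem Selection.dim_eq (σ : Selection.{v, u, w} X) (c : Dual.{v, u, w} X) (x : a ⟶ b) :
    σ.dim c a = σ.dim c b :=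
  (σ.rep c).finrank_eq x

theorem Selection.op_comp (σ : Selection.{v, u, w} X) (c : Dual.{v, u, w} X) (x : a ⟶ b)
    (y : b ⟶ d) : σ.op c (x ≫ y) = (σ.op c y).comp (σ.op c x) :=
  ContinuousLinearMap.ext fun z => (σ.rep c).op_mul x y z

theorem Selection.adjoint_op (σ : Selection.{v, u, w} X) (c : Dual.{v, u, w} X) (x : a ⟶ b) :
    ContinuousLinearMap.adjoint (σ.op c x) = σ.op c (Groupoid.inv x) :=
  (σ.rep c).adjoint_opCLM x

variable [IsTopologicalGroupoid X] [CompactSpace (Quiver.Total X)] [T2Space X]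

theorem Selection.dim_eq_of_ne_zero {c : Dual.{v, u, w} X} {T : σ.fib c b →L[ℂ] σ.fib c a}
    (hT : T ≠ 0) : σ.dim c a = σ.dim c b :=
  let ⟨x⟩ := (σ.isIrreducible c).nonempty_hom hT
  σ.dim_eq c x

variable (μ : NormalizedHaarSystem X)
include μ

theorem Selection.finiteDimensional (σ : Selection.{v, u, w} X) (c : Dual.{v, u, w} X) (a : X) :
    FiniteDimensional ℂ (σ.fib c a) :=
  (σ.isIrreducible c).finiteDimensional μ a

theorem continuous_invFourier (h : OpSum σ b a) : Continuous (invFourier σ h) := by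
  obtain ⟨s, hs⟩ := h.exists_finset
  have hf : invFourier σ h = fun x => ∑ c ∈ s, (σ.dim c a : ℂ) *
      LinearMap.trace ℂ (σ.fib c a) ((h c).comp (σ.op c x)).toLinearMap :=
    funext fun x => invFourier_eq_sum hs x
  rw [hf]
  refine continuous_finsetSum _ fun c _ => continuous_const.mul ?_
  have := σ.finiteDimensional μ c a
  exact Rep.continuous_trace_comp_opCLM (h c)

theorem continuous_invFourierOp (h : OpSum σ b a) : Continuous (invFourierOp σ h) :=
  (continuous_invFourier μ h).comp (continuous_groupoid_inv b a)

theorem fourier_invFourier (h : OpSum σ b a) (c : Dual.{v, u, w} X) :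
    fourier μ σ (invFourier σ h) c = h c := by
  have := fun c => σ.finiteDimensional μ c a
  have := fun c => σ.finiteDimensional μ c b
  obtain ⟨s, hs⟩ := h.exists_finset
  have h1 (c' : Dual.{v, u, w} X) : Continuous fun x : a ⟶ b =>
      LinearMap.trace ℂ (σ.fib c' a) ((h c').comp (σ.op c' x)).toLinearMap :=
    Rep.continuous_trace_comp_opCLM (h c')
  have h2 : Continuous fun x : a ⟶ b => σ.op c (Groupoid.inv x) := Rep.continuous_opCLM_inv
  have h3 (c' : Dual.{v, u, w} X) : Continuous fun x : a ⟶ b =>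
      LinearMap.trace ℂ (σ.fib c' a) ((h c').comp (σ.op c' x)).toLinearMap •
        σ.op c (Groupoid.inv x) := (h1 c').smul h2
  have hc (c' : Dual.{v, u, w} X) : Continuous fun x : a ⟶ b => (σ.dim c' a : ℂ) •
      LinearMap.trace ℂ (σ.fib c' a) ((h c').comp (σ.op c' x)).toLinearMap •
        σ.op c (Groupoid.inv x) := (h3 c').const_smul (σ.dim c' a : ℂ)
  simp only [fourier, invFourier_eq_sum hs, Finset.sum_smul, mul_smul]
  rw [integral_finsetSum _ fun c' _ => μ.integrable (hc c')]
  simp only [integral_smul]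
  rw [Finset.sum_eq_single c]
  · exact finrank_smul_integral_trace_smul_op_inv μ (σ.isIrreducible c) (h c)
  · intro c' _ hne
    have h0 := integral_trace_smul_op_inv_eq_zero μ (σ.isIrreducible c') (σ.isIrreducible c)
      (σ.not_unitaryEquiv hne) (h c')
    exact (congrArg _ h0).trans (smul_zero _)
  · intro hcs
    simp [hs c hcs]

theorem fourierOp_invFourierOp (h : OpSum σ b a) (c : Dual.{v, u, w} X) :
    fourierOp μ σ (invFourierOp σ h) c = h c := by
  have := fun c => σ.finiteDimensional μ c a
  have := fun c => σ.finiteDimensional μ c b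
  obtain ⟨s, hs⟩ := h.exists_finset
  have h1 (c' : Dual.{v, u, w} X) : Continuous fun x : b ⟶ a =>
      LinearMap.trace ℂ (σ.fib c' a) ((h c').comp (σ.op c' (Groupoid.inv x))).toLinearMap :=
    (Rep.continuous_trace_comp_opCLM (h c')).comp (continuous_groupoid_inv b a)
  have h2 : Continuous fun x : b ⟶ a => σ.op c x := Rep.continuous_opCLM
  have h3 (c' : Dual.{v, u, w} X) : Continuous fun x : b ⟶ a =>
      LinearMap.trace ℂ (σ.fib c' a)
        ((h c').comp (σ.op c' (Groupoid.inv x))).toLinearMap • σ.op c x := (h1 c').smul h2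
  have hc (c' : Dual.{v, u, w} X) : Continuous fun x : b ⟶ a => (σ.dim c' a : ℂ) •
      LinearMap.trace ℂ (σ.fib c' a)
        ((h c').comp (σ.op c' (Groupoid.inv x))).toLinearMap • σ.op c x :=
    (h3 c').const_smul (σ.dim c' a : ℂ)
  simp only [fourierOp, invFourierOp_eq, invFourier_eq_sum hs, Finset.sum_smul, mul_smul]
  rw [integral_finsetSum _ fun c' _ => μ.integrable (hc c')]
  simp only [integral_smul]
  rw [Finset.sum_eq_single c]
  · exact finrank_smul_integral_trace_smul_op μ (σ.isIrreducible c) (h c)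
  · intro c' _ hne
    have h0 := integral_trace_smul_op_eq_zero μ (σ.isIrreducible c') (σ.isIrreducible c)
      (σ.not_unitaryEquiv hne) (h c')
    exact (congrArg _ h0).trans (smul_zero _)
  · intro hcs
    simp [hs c hcs]

/-- Integrals of a function against coefficients, in terms of its Fourier transform. -/
theorem integral_sum_trace_mul {f : (a ⟶ b) → ℂ} (hf : Continuous f)
    (s : Finset (Dual.{v, u, w} X)) (t : Dual.{v, u, w} X → ℂ)
    (K : ∀ c, σ.fib c a →L[ℂ] σ.fib c b) :
    ∫ x, (∑ c ∈ s, t c * LinearMap.trace ℂ (σ.fib c b)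
      ((K c).comp (σ.op c (Groupoid.inv x))).toLinearMap) * f x ∂(μ.measure a b) =
    ∑ c ∈ s, t c * LinearMap.trace ℂ (σ.fib c b) ((K c).comp (fourier μ σ f c)).toLinearMap := by
  have := fun c => σ.finiteDimensional μ c a
  have := fun c => σ.finiteDimensional μ c b
  have hg (c) : Continuous fun x : a ⟶ b => f x • σ.op c (Groupoid.inv x) :=
    hf.smul Rep.continuous_opCLM_inv
  have hc (c) : Continuous fun x : a ⟶ b => t c * LinearMap.trace ℂ (σ.fib c b)
      ((K c).comp (f x • σ.op c (Groupoid.inv x))).toLinearMap :=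
    continuous_const.mul (continuous_trace fun z => (K c).continuous.comp
      ((hg c).clm_apply continuous_const))
  simp only [fourier]
  rw [Finset.sum_congr rfl fun c _ =>
    congrArg (t c * ·) (trace_comp_integral (μ.integrable (hg c)) (K c))]
  simp only [← integral_const_mul]
  rw [← integral_finsetSum _ fun c _ => μ.integrable (hc c)]
  refine integral_congr_ae (Filter.Eventually.of_forall fun x => ?_)
  simp only [Finset.sum_mul, ContinuousLinearMap.comp_smul, ContinuousLinearMap.toLinearMap_smul,
    map_smul, smul_eq_mul]
  exact Finset.sum_congr rfl fun c _ => by ring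

/-- Integrals of a function against coefficients, in terms of its Fourier transform. -/
theorem integral_sum_trace_mul_op {f : (b ⟶ a) → ℂ} (hf : Continuous f)
    (s : Finset (Dual.{v, u, w} X)) (t : Dual.{v, u, w} X → ℂ)
    (K : ∀ c, σ.fib c a →L[ℂ] σ.fib c b) :
    ∫ x, (∑ c ∈ s, t c * LinearMap.trace ℂ (σ.fib c b)
      ((K c).comp (σ.op c x)).toLinearMap) * f x ∂(μ.measure b a) =
    ∑ c ∈ s, t c * LinearMap.trace ℂ (σ.fib c b) ((K c).comp (fourierOp μ σ f c)).toLinearMap := by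
  have := fun c => σ.finiteDimensional μ c a
  have := fun c => σ.finiteDimensional μ c b
  have hg (c) : Continuous fun x : b ⟶ a => f x • σ.op c x :=
    hf.smul Rep.continuous_opCLM
  have hc (c) : Continuous fun x : b ⟶ a => t c * LinearMap.trace ℂ (σ.fib c b)
      ((K c).comp (f x • σ.op c x)).toLinearMap :=
    continuous_const.mul (continuous_trace fun z => (K c).continuous.comp
      ((hg c).clm_apply continuous_const))
  simp only [fourierOp]
  rw [Finset.sum_congr rfl fun c _ =>
    congrArg (t c * ·) (trace_comp_integral (μ.integrable (hg c)) (K c))]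
  simp only [← integral_const_mul]
  rw [← integral_finsetSum _ fun c _ => μ.integrable (hc c)]
  refine integral_congr_ae (Filter.Eventually.of_forall fun x => ?_)
  simp only [Finset.sum_mul, ContinuousLinearMap.comp_smul, ContinuousLinearMap.toLinearMap_smul,
    map_smul, smul_eq_mul]
  exact Finset.sum_congr rfl fun c _ => by ring

/-- At `x`, the convolution integrates the transform of `h` against traces of `k(π) π(x) π(y⁻¹)`, so
inversion replaces the integral by `h(π)`. -/
theorem invFourier_mul (h : OpSum σ b a) (k : OpSum σ d b) :
    invFourier σ (h.mul k) = conv μ (invFourier σ k) (invFourier σ h) := by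
  have := fun c => σ.finiteDimensional μ c a
  have := fun c => σ.finiteDimensional μ c b
  have := fun c => σ.finiteDimensional μ c d
  obtain ⟨s, hs⟩ := k.exists_finset
  have hs' : ∀ c ∉ s, h.mul k c = 0 := fun c hc => by simp [hs c hc]
  ext x
  have key := integral_sum_trace_mul μ (continuous_invFourier μ h) s (fun c => (σ.dim c b : ℂ))
    fun c => (k c).comp (σ.op c x)
  simp only [conv, invFourier_eq_sum hs, σ.op_comp, ← ContinuousLinearMap.comp_assoc] at key ⊢
  rw [key, invFourier_eq_sum hs']
  refine Finset.sum_congr rfl fun c _ => ?_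
  rw [fourier_invFourier, OpSum.mul_apply]
  -- The transform of `k` contributes the dimension over `b`, while the product needs the one over
  -- `a`; they agree unless `h c` vanishes.
  by_cases h0 : h c = 0
  · simp [h0]
  · rw [Selection.dim_eq_of_ne_zero h0, ContinuousLinearMap.comp_assoc, trace_comp_comm]

theorem invFourierOp_mul (h : OpSum σ b a) (k : OpSum σ d b) :
    invFourierOp σ (h.mul k) = conv μ (invFourierOp σ h) (invFourierOp σ k) := by
  have := fun c => σ.finiteDimensional μ c a
  have := fun c => σ.finiteDimensional μ c b
  have := fun c => σ.finiteDimensional μ c d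
  obtain ⟨s, hs⟩ := h.exists_finset
  have hs' : ∀ c ∉ s, h.mul k c = 0 := fun c hc => by simp [hs c hc]
  ext x
  have key := integral_sum_trace_mul_op μ (continuous_invFourierOp μ k) s
    (fun c => (σ.dim c a : ℂ)) fun c => (σ.op c (Groupoid.inv x)).comp (h c)
  -- Cyclicity of the trace isolates `π(y)` on the right, ready for the Fourier integral in `y`.
  have hx (y : d ⟶ b) : invFourierOp σ h (Groupoid.inv y ≫ x) = ∑ c ∈ s, (σ.dim c a : ℂ) *
      LinearMap.trace ℂ (σ.fib c d)
        (((σ.op c (Groupoid.inv x)).comp (h c)).comp (σ.op c y)).toLinearMap := by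
    have hinv : Groupoid.inv (Groupoid.inv y ≫ x) = Groupoid.inv x ≫ y := by
      simp [Groupoid.inv_eq_inv]
    rw [invFourierOp_eq, invFourier_eq_sum hs, hinv]
    refine Finset.sum_congr rfl fun c _ => ?_
    rw [σ.op_comp, ← ContinuousLinearMap.comp_assoc, trace_comp_comm,
      ContinuousLinearMap.comp_assoc]
  simp only [conv, hx]
  rw [key, invFourierOp_eq, invFourier_eq_sum hs']
  refine Finset.sum_congr rfl fun c _ => ?_
  rw [fourierOp_invFourierOp, OpSum.mul_apply, trace_comp_comm, ContinuousLinearMap.comp_assoc]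

theorem invFourier_star (h : OpSum σ b a) :
    invFourier σ h.star = involution (invFourier σ h) := by
  have := fun c => σ.finiteDimensional μ c a
  have := fun c => σ.finiteDimensional μ c b
  obtain ⟨s, hs⟩ := h.exists_finset
  have hs' : ∀ c ∉ s, h.star c = 0 := fun c hc => by simp [hs c hc]
  ext x
  rw [involution, invFourier_eq_sum hs', invFourier_eq_sum hs, map_sum]
  refine Finset.sum_congr rfl fun c _ => ?_
  rw [map_mul, Complex.conj_natCast, σ.dim_eq c x, ← trace_adjoint,
    ContinuousLinearMap.adjoint_comp, ← σ.adjoint_op, ContinuousLinearMap.adjoint_adjoint,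
    trace_comp_comm, OpSum.star_apply]

theorem invFourierOp_star (h : OpSum σ b a) :
    invFourierOp σ h.star = involution (invFourierOp σ h) := by
  ext x
  rw [invFourierOp_eq, invFourier_star μ]
  rfl

/-- Conjugation passes to the adjoint inside the trace, which puts the first factor of the inner
product in the form `K π(x⁻¹)`. -/
theorem conj_invFourier {h : OpSum σ b a} {s : Finset (Dual.{v, u, w} X)}
    (hs : ∀ c ∉ s, h c = 0) (x : a ⟶ b) :
    starRingEnd ℂ (invFourier σ h x) = ∑ c ∈ s, (σ.dim c a : ℂ) * LinearMap.trace ℂ (σ.fib c b)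
      ((ContinuousLinearMap.adjoint (h c)).comp (σ.op c (Groupoid.inv x))).toLinearMap := by
  have := fun c => σ.finiteDimensional μ c a
  have := fun c => σ.finiteDimensional μ c b
  rw [invFourier_eq_sum hs, map_sum]
  refine Finset.sum_congr rfl fun c _ => ?_
  rw [map_mul, Complex.conj_natCast, ← trace_adjoint, ContinuousLinearMap.adjoint_comp,
    σ.adjoint_op, trace_comp_comm]

theorem ip_invFourier (h k : OpSum σ b a) :
    ip μ (invFourier σ h) (invFourier σ k) = h.ip k := by
  obtain ⟨s, hs⟩ := h.exists_finset
  simp only [ip, conj_invFourier μ hs]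
  rw [integral_sum_trace_mul μ (continuous_invFourier μ k), OpSum.ip_eq_sum hs]
  simp only [fourier_invFourier]

theorem ip_invFourierOp (h k : OpSum σ b a) :
    ip μ (invFourierOp σ h) (invFourierOp σ k) = h.ip k := by
  obtain ⟨s, hs⟩ := h.exists_finset
  have hinv (x : b ⟶ a) : Groupoid.inv (Groupoid.inv x) = x := by simp [Groupoid.inv_eq_inv]
  simp only [ip, invFourierOp_eq h, conj_invFourier μ hs, hinv]
  rw [integral_sum_trace_mul_op μ (continuous_invFourierOp μ k), OpSum.ip_eq_sum hs]
  simp only [fourierOp_invFourierOp]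

end Fourier

end CptGroupoid

end

theorem mainTheorem5 {X : Type u} [Groupoid.{v} X] [TopologicalSpace X]
    [TopologicalSpace (Quiver.Total X)] [CptGroupoid.IsTopologicalGroupoid X]
    [CompactSpace (Quiver.Total X)] [T2Space X] [∀ a b : X, T2Space (a ⟶ b)]
    (μ : CptGroupoid.NormalizedHaarSystem X) (σ : CptGroupoid.Selection.{v, u, w} X) (a b : X) :
    -- the transforms with kernels `π(x⁻¹)` and `π(x)`, on functions on `𝒢_a^b`
    ((∀ h : CptGroupoid.OpSum σ b a, Continuous (CptGroupoid.invFourier σ h)) ∧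
      (∀ (h : CptGroupoid.OpSum σ b a) (c : CptGroupoid.Dual.{v, u, w} X),
        CptGroupoid.fourier μ σ (CptGroupoid.invFourier σ h) c = h c) ∧
      (∀ (d : X) (h : CptGroupoid.OpSum σ b a) (k : CptGroupoid.OpSum σ d b),
        CptGroupoid.invFourier σ (h.mul k) =
          CptGroupoid.conv μ (CptGroupoid.invFourier σ k) (CptGroupoid.invFourier σ h)) ∧
      (∀ h : CptGroupoid.OpSum σ b a,
        CptGroupoid.invFourier σ h.star =
          CptGroupoid.involution (CptGroupoid.invFourier σ h)) ∧
      (∀ h k : CptGroupoid.OpSum σ b a,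
        CptGroupoid.ip μ (CptGroupoid.invFourier σ h) (CptGroupoid.invFourier σ k) =
          h.ip k)) ∧
    -- the transforms with kernels `π(x)` and `π(x⁻¹)`, on functions on `𝒢_b^a`
    ((∀ h : CptGroupoid.OpSum σ b a, Continuous (CptGroupoid.invFourierOp σ h)) ∧
      (∀ (h : CptGroupoid.OpSum σ b a) (c : CptGroupoid.Dual.{v, u, w} X),
        CptGroupoid.fourierOp μ σ (CptGroupoid.invFourierOp σ h) c = h c) ∧
      (∀ (d : X) (h : CptGroupoid.OpSum σ b a) (k : CptGroupoid.OpSum σ d b),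
        CptGroupoid.invFourierOp σ (h.mul k) =
          CptGroupoid.conv μ (CptGroupoid.invFourierOp σ h) (CptGroupoid.invFourierOp σ k)) ∧
      (∀ h : CptGroupoid.OpSum σ b a,
        CptGroupoid.invFourierOp σ h.star =
          CptGroupoid.involution (CptGroupoid.invFourierOp σ h)) ∧
      (∀ h k : CptGroupoid.OpSum σ b a,
        CptGroupoid.ip μ (CptGroupoid.invFourierOp σ h) (CptGroupoid.invFourierOp σ k) =
          h.ip k)) := by
  exact
    ⟨⟨CptGroupoid.continuous_invFourier μ, CptGroupoid.fourier_invFourier μ,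
        fun _ => CptGroupoid.invFourier_mul μ, CptGroupoid.invFourier_star μ,
        CptGroupoid.ip_invFourier μ⟩,
      ⟨CptGroupoid.continuous_invFourierOp μ, CptGroupoid.fourierOp_invFourierOp μ,
        fun _ => CptGroupoid.invFourierOp_mul μ, CptGroupoid.invFourierOp_star μ,
        CptGroupoid.ip_invFourierOp μ⟩⟩
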